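/- **Conventions.** Let $p$ be a prime. Subgroups of profinite groups are closed and homomorphisms between profinite groups are continuous. A *fusion system* on a finite $p$-group $S$ is a category whose objects are the subgroups of $S$ and whose morphisms are injective group homomorphisms, such that every homomorphism $P\to Q$ ($P,Q\le S$) induced by conjugation by an element of $S$ is a morphism, and every morphism is an isomorphism of the category followed by an inclusion. Let $\mathcal F$ and $\mathcal G$ be categories whose objects are the subgroups of profinite groups $S$ and $T$, respectively, and whose morphisms are homomorphisms. A *morphism* $\mathcal F\to\mathcal G$ is a homomorphism $\alpha:S\to T$ for which there is a functor $A:\mathcal F\to\mathcal G$ with $A(P)=\alpha(P)$ for all $P\le S$ and $A(\varphi)\circ\alpha|_P=\alpha\circ\varphi$ for all $\varphi\in\mathrm{Hom}_{\mathcal F}(P,Q)$; it is an isomorphism if it has an inverse morphism. Let $(\mathcal F_i)_{i\in I}$ be an inverse system of fusion systems on finite $p$-groups $S_i$, indexed by a directed partially ordered set $I$. Let $S=\varprojlim S_i$, with projections $f_i:S\to S_i$. The *inverse limit* $\varprojlim\mathcal F_i$ is the category with objects the subgroups of the pro-$p$ group $S$ and with $\mathrm{Hom}(P,Q)=\varprojlim_i\mathrm{Hom}_{\mathcal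 F_i}(f_i(P),f_i(Q))$, whose elements are regarded as homomorphisms $P\to Q$. A *pro-fusion system* on a pro-$p$ group $S$ is a category of subgroups of $S$ isomorphic to such an inverse limit; $\mathrm{Aut}_{\mathcal F}(P)$ is then naturally a profinite group. Let $\mathcal F$ be a pro-fusion system on $S$ and $Q\le S$ (finite $p$-groups are included). Let $\mathrm{Aut}_S(Q)\le\mathrm{Aut}_{\mathcal F}(Q)$ be the group of automorphisms of $Q$ induced by conjugation by elements of $N_S(Q)$. * $Q$ is *receptive* if for every $R\le S$ and every isomorphism $\varphi:R\to Q$ of $\mathcal F$ there is a morphism $\tilde\varphi:N_\varphi\to N_S(Q)$ of $\mathcal F$ with $\tilde\varphi|_R=\varphi$, where $$N_\varphi=\{x\in N_S(R)\mid \exists\, y\in N_S(Q)\ \forall u\in R:\ \varphi(xux^{-1})=y\varphi(u)y^{-1}\}.$$ * $Q$ is *fully automized* if $\mathrm{Aut}_S(Q)$ is a Sylow pro-$p$ subgroup of $\mathrm{Aut}_{\mathcal F}(Q)$. * $\mathcal F$ is *saturated* if every $\mathcal F$-isomorphism class of subgroups of $S$ contains a subgroup that is both receptive and fully automized. A pro-fusion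 system is *countably based* if it is isomorphic to an inverse limit of fusion systems on finite $p$-groups indexed by $\mathbb N$ with its usual order, and *pro-saturated* if it is isomorphic to an inverse limit, over some directed set, of saturated fusion systems on finite $p$-groups. **Theorem.** Let $\mathcal F$ be a pro-fusion system on a pro-$p$ group $S$. If $\mathcal F$ is countably based and pro-saturated, then $\mathcal F$ is saturated. -/

import Mathlib

universe u v w x

/-- The image of a closed subgroup of a compact group under a continuous homomorphism to a
Hausdorff group, as a closed subgroup. -/
def ClosedSubgroup.image {S : Type u} {T : Type v} [Group S] [TopologicalSpace S] [CompactSpace S]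
    [Group T] [TopologicalSpace T] [T2Space T] (α : S →ₜ* T) (P : ClosedSubgroup S) :
    ClosedSubgroup T where
  toSubgroup := P.toSubgroup.map α.toMonoidHom
  isClosed' := (P.isClosed'.isCompact.image α.continuous_toFun).isClosed

theorem ClosedSubgroup.apply_mem_image {S : Type u} {T : Type v} [Group S] [TopologicalSpace S]
    [CompactSpace S] [Group T] [TopologicalSpace T] [T2Space T] (α : S →ₜ* T)
    (P : ClosedSubgroup S) (a : P) : α a ∈ P.image α :=
  ⟨a, a.2, rfl⟩

/-- The normalizer `N_S(Q)` of a closed subgroup, as a closed subgroup. -/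
def ClosedSubgroup.normalizer {S : Type u} [Group S] [TopologicalSpace S] [IsTopologicalGroup S]
    (Q : ClosedSubgroup S) : ClosedSubgroup S where
  toSubgroup := Subgroup.normalizer (Q : Set S)
  isClosed' := by
    have h : (Subgroup.normalizer (Q : Set S)).carrier =
        (⋂ n ∈ (Q : Set S), {g : S | g * n * g⁻¹ ∈ (Q : Set S)}) ∩
        (⋂ n ∈ (Q : Set S), {g : S | g⁻¹ * n * g ∈ (Q : Set S)}) := by
      ext g
      simp only [Set.mem_inter_iff, Set.mem_iInter, Set.mem_ofPred_eq]
      constructor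
      · intro hg
        refine ⟨fun n hn => (hg n).1 hn, fun n hn => (hg _).2 ?_⟩
        simpa [mul_assoc] using hn
      · rintro ⟨h1, h2⟩ n
        refine ⟨h1 n, fun hn => ?_⟩
        simpa [mul_assoc] using h2 _ hn
    rw [h]
    have hQ : IsClosed (Q : Set S) := Q.isClosed'
    refine (isClosed_biInter fun n _ => ?_).inter (isClosed_biInter fun n _ => ?_)
    · exact hQ.preimage (by fun_prop)
    · exact hQ.preimage (by fun_prop)

/-- A category whose objects are the closed subgroups of `S` and whose morphisms are continuous
group homomorphisms between them. If `S` is discrete, this involves all subgroups of `S` and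
all homomorphisms. -/
structure SubgroupCategory (S : Type u) [Group S] [TopologicalSpace S] where
  Hom : ∀ P Q : ClosedSubgroup S, Set (P →ₜ* Q)
  id_mem : ∀ P : ClosedSubgroup S, ContinuousMonoidHom.id P ∈ Hom P P
  comp_mem : ∀ {P Q R : ClosedSubgroup S} {φ : P →ₜ* Q} {ψ : Q →ₜ* R},
    φ ∈ Hom P Q → ψ ∈ Hom Q R → ψ.comp φ ∈ Hom P R

namespace SubgroupCategory

section Basic

variable {S : Type u} [Group S] [TopologicalSpace S] (F : SubgroupCategory S)

/-- `φ` is an isomorphism of the category `F`: it is a morphism of `F` with an inverse in `F`. -/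
def IsIso {P Q : ClosedSubgroup S} (φ : P →ₜ* Q) : Prop :=
  φ ∈ F.Hom P Q ∧ ∃ ψ ∈ F.Hom Q P, (∀ a, ψ (φ a) = a) ∧ ∀ b, φ (ψ b) = b

/-- The axioms of a fusion system on `S` (used when `S` is a finite, discrete `p`-group). -/
structure IsFusionSystem : Prop where
  injective : ∀ {P Q : ClosedSubgroup S} {φ : P →ₜ* Q}, φ ∈ F.Hom P Q → Function.Injective φ
  conj_mem : ∀ {P Q : ClosedSubgroup S} (φ : P →ₜ* Q) (s : S),
    (∀ a : P, (φ a : S) = s * a * s⁻¹) → φ ∈ F.Hom P Q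
  factor : ∀ {P Q : ClosedSubgroup S} {φ : P →ₜ* Q}, φ ∈ F.Hom P Q →
    ∃ R ≤ Q, ∃ ψ : P →ₜ* R, F.IsIso ψ ∧ ∀ a : P, (ψ a : S) = φ a

/-- The group `Aut_F(P)` of automorphisms of `P` in the category `F`. -/
def aut (P : ClosedSubgroup S) : Subgroup (MulAut P) where
  carrier := {e | (∃ φ ∈ F.Hom P P, ∀ a, φ a = e a) ∧ ∃ ψ ∈ F.Hom P P, ∀ a, ψ a = e⁻¹ a}
  one_mem' := ⟨⟨_, F.id_mem P, fun _ => rfl⟩, ⟨_, F.id_mem P, fun _ => rfl⟩⟩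
  mul_mem' := by
    rintro e f ⟨⟨φ, hφ, hφe⟩, ψ, hψ, hψe⟩ ⟨⟨φ', hφ', hφe'⟩, ψ', hψ', hψe'⟩
    refine ⟨⟨_, F.comp_mem hφ' hφ, fun a => ?_⟩, _, F.comp_mem hψ hψ', fun a => ?_⟩
    · change φ (φ' a) = e (f a)
      rw [hφe', hφe]
    · rw [mul_inv_rev]
      change ψ' (ψ a) = f⁻¹ (e⁻¹ a)
      rw [hψe, hψe']
  inv_mem' := by
    rintro e ⟨h1, h2⟩
    exact ⟨h2, by rwa [inv_inv]⟩

theorem continuous_aut {P : ClosedSubgroup S} (e : F.aut P) :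
    Continuous (fun a : P => (e : MulAut P) a) := by
  obtain ⟨φ, -, h⟩ := e.2.1
  exact φ.continuous_toFun.congr h

/-- An element of `Aut_F(P)` as a continuous map. -/
def autToMap {P : ClosedSubgroup S} (e : F.aut P) : C(P, P) :=
  ⟨fun a => (e : MulAut P) a, F.continuous_aut e⟩

/-- The natural topology of `Aut_F(P)`, that of uniform convergence on `P`. When `F` is the
inverse limit of categories `F i` on finite groups, a base of neighbourhoods of `1` is formed by
the automorphisms that induce the identity in `F i`, so this is the profinite topology of the
inverse limit of the finite groups of automorphisms in the `F i`. -/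
instance instTopologicalSpaceAut (P : ClosedSubgroup S) : TopologicalSpace (F.aut P) :=
  TopologicalSpace.induced F.autToMap ContinuousMap.compactOpen

/-- `Aut_S(Q)`: the automorphisms in `Aut_F(Q)` induced by conjugation with elements of
`N_S(Q)`. -/
def autInner (Q : ClosedSubgroup S) : Subgroup (F.aut Q) where
  carrier := {e | ∃ s ∈ Subgroup.normalizer (Q : Set S),
    ∀ a : Q, ((e : MulAut Q) a : S) = s * a * s⁻¹}
  one_mem' := ⟨1, one_mem _, fun a => by simp⟩
  mul_mem' := by
    rintro e f ⟨s, hs, hse⟩ ⟨t, ht, htf⟩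
    refine ⟨s * t, mul_mem hs ht, fun a => ?_⟩
    change (((e : MulAut Q) ((f : MulAut Q) a) : Q) : S) = _
    rw [hse, htf]
    group
  inv_mem' := by
    rintro e ⟨s, hs, hse⟩
    refine ⟨s⁻¹, inv_mem hs, fun a => ?_⟩
    have h := hse (((e : MulAut Q)⁻¹) a)
    rw [MulAut.apply_inv_self] at h
    rw [h, Subgroup.coe_inv]
    group

end Basic

section Saturation

/-- A pro-`p` group: a profinite group all of whose quotients by open normal subgroups are
`p`-groups. -/
structure IsProPGroup (p : ℕ) (G : Type u) [Group G] [TopologicalSpace G] : Prop where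
  isTopologicalGroup : IsTopologicalGroup G
  compactSpace : CompactSpace G
  totallyDisconnectedSpace : TotallyDisconnectedSpace G
  isPGroup_quotient : ∀ (U : Subgroup G) [U.Normal], IsOpen (U : Set G) → IsPGroup p (G ⧸ U)

/-- `H` is a Sylow pro-`p` subgroup of the profinite group `G`: it is a closed pro-`p` subgroup
whose index is prime to `p`, the index being the least common multiple of the indices
`|G : HU|` over all open normal subgroups `U` of `G`. -/
structure IsSylowProP (p : ℕ) {G : Type u} [Group G] [TopologicalSpace G] (H : Subgroup G) :
    Prop where
  isClosed : IsClosed (H : Set G)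
  isProPGroup : IsProPGroup p H
  not_dvd_index : ∀ U : Subgroup G, U.Normal → IsOpen (U : Set G) → ¬ p ∣ (H ⊔ U).index

variable {S : Type u} [Group S] [TopologicalSpace S]

/-- For `φ : R → Q`, the closed subgroup `N_φ` of those `a ∈ N_S(R)` for which there is
`b ∈ N_S(Q)` such that `φ(a r a⁻¹) = b φ(r) b⁻¹` for all `r ∈ R` (below, `r'` is the element
`a r a⁻¹` of `R`). -/
def extender [IsTopologicalGroup S] [CompactSpace S] [T2Space S] {R Q : ClosedSubgroup S}
    (φ : R →ₜ* Q) : ClosedSubgroup S where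
  carrier := {a | a ∈ R.normalizer ∧ ∃ b ∈ Q.normalizer, ∀ r r' : R,
    (r' : S) = a * r * a⁻¹ → (φ r' : S) = b * φ r * b⁻¹}
  one_mem' := by
    refine ⟨one_mem _, 1, one_mem _, fun r r' h => ?_⟩
    have : r' = r := Subtype.ext (by simpa using h)
    simp [this]
  mul_mem' := by
    rintro a a' ⟨ha, b, hb, h⟩ ⟨ha', b', hb', h'⟩
    refine ⟨mul_mem ha ha', b * b', mul_mem hb hb', fun r r' hr => ?_⟩
    have hm : a' * r * a'⁻¹ ∈ R := (ha' r).1 r.2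
    rw [h ⟨_, hm⟩ r' (by rw [hr]; group), h' r ⟨_, hm⟩ rfl]
    group
  inv_mem' := by
    rintro a ⟨ha, b, hb, h⟩
    refine ⟨inv_mem ha, b⁻¹, inv_mem hb, fun r r' hr => ?_⟩
    rw [h r' r (by rw [hr]; group)]
    group
  isClosed' := by
    let C : Set (S × S) := {z | z.1 ∈ (R.normalizer : Set S)} ∩ {z | z.2 ∈ (Q.normalizer : Set S)} ∩
      {z | ∀ r r' : R, (r' : S) = z.1 * r * z.1⁻¹ → (φ r' : S) = z.2 * φ r * z.2⁻¹}
    have hR : IsClosed (R.normalizer : Set S) := R.normalizer.isClosed'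
    have hQ : IsClosed (Q.normalizer : Set S) := Q.normalizer.isClosed'
    have hRc : IsClosed (R : Set S) := R.isClosed'
    have hC : IsClosed C := by
      let N := {z : S × S | z.1 ∈ (R.normalizer : Set S)} ∩ {z | z.2 ∈ (Q.normalizer : Set S)}
      have hN : IsClosed N := (hR.preimage continuous_fst).inter (hQ.preimage continuous_snd)
      have key : IsClosed {z : N | ∀ r : R,
          (φ ⟨z.1.1 * r * z.1.1⁻¹, (z.2.1 r).1 r.2⟩ : S) = z.1.2 * φ r * z.1.2⁻¹} := by
        simp only [Set.ofPred_forall]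
        refine isClosed_iInter fun r => isClosed_eq ?_ ?_
        · exact continuous_subtype_val.comp (φ.continuous_toFun.comp
            (Continuous.subtype_mk (by fun_prop) _))
        · fun_prop
      have := hN.isClosedEmbedding_subtypeVal.isClosedMap _ key
      convert this using 1
      ext z
      constructor
      · rintro ⟨hz, h⟩
        exact ⟨⟨z, hz⟩, fun r => h r ⟨_, (hz.1 r).1 r.2⟩ rfl, rfl⟩
      · rintro ⟨⟨z, hz⟩, h, rfl⟩
        refine ⟨hz, fun r r' hr => ?_⟩
        have : r' = ⟨_, (hz.1 r).1 r.2⟩ := Subtype.ext hr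
        rw [this]
        exact h r
    have himg : IsClosed (Prod.fst '' C) := (hC.isCompact.image continuous_fst).isClosed
    convert himg using 1
    ext a
    constructor
    · rintro ⟨ha, b, hb, h⟩
      exact ⟨(a, b), ⟨⟨ha, hb⟩, h⟩, rfl⟩
    · rintro ⟨⟨a, b⟩, ⟨⟨ha, hb⟩, h⟩, rfl⟩
      exact ⟨ha, b, hb, h⟩

theorem le_extender [IsTopologicalGroup S] [CompactSpace S] [T2Space S] {R Q : ClosedSubgroup S}
    (φ : R →ₜ* Q) (r : R) : (r : S) ∈ extender φ := by
  refine ⟨Subgroup.le_normalizer (H := R.toSubgroup) r.2, φ r,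
    Subgroup.le_normalizer (H := Q.toSubgroup) (φ r).2, fun t t' h => ?_⟩
  have : t' = r * t * r⁻¹ := Subtype.ext h
  simp [this]

/-- `Q` is receptive in `F`: every isomorphism `φ : R → Q` of `F` extends to a morphism
`N_φ → N_S(Q)` of `F`. -/
def IsReceptive [IsTopologicalGroup S] [CompactSpace S] [T2Space S] (F : SubgroupCategory S)
    (Q : ClosedSubgroup S) : Prop :=
  ∀ (R : ClosedSubgroup S) (φ : R →ₜ* Q), F.IsIso φ →
    ∃ ψ ∈ F.Hom (extender φ) Q.normalizer, ∀ r : R, (ψ ⟨r, le_extender φ r⟩ : S) = φ r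

/-- `Q` is fully automized in `F`: `Aut_S(Q)` is a Sylow pro-`p` subgroup of `Aut_F(Q)`. -/
def IsFullyAutomized (p : ℕ) (F : SubgroupCategory S) (Q : ClosedSubgroup S) : Prop :=
  IsSylowProP p (F.autInner Q)

/-- `Q` is fully normalized in `F`: it is receptive and fully automized. -/
def IsFullyNormalized [IsTopologicalGroup S] [CompactSpace S] [T2Space S] (p : ℕ)
    (F : SubgroupCategory S) (Q : ClosedSubgroup S) : Prop :=
  F.IsReceptive Q ∧ F.IsFullyAutomized p Q

/-- `F` is saturated: every isomorphism class of `F` contains a fully normalized subgroup. -/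
def IsSaturated [IsTopologicalGroup S] [CompactSpace S] [T2Space S] (p : ℕ)
    (F : SubgroupCategory S) : Prop :=
  ∀ P : ClosedSubgroup S, ∃ Q : ClosedSubgroup S,
    (∃ φ : P →ₜ* Q, F.IsIso φ) ∧ F.IsFullyNormalized p Q

end Saturation

section Morphisms

variable {S : Type u} [Group S] [TopologicalSpace S] [CompactSpace S]
  {T : Type v} [Group T] [TopologicalSpace T] [CompactSpace T]

/-- `α : S → T` is a morphism from `F` to `G`: each morphism `φ : P → Q` of `F` induces a
morphism `ψ : α(P) → α(Q)` of `G`, in the sense that `ψ α = α φ` on `P`. Such a `ψ` is unique,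
hence depends functorially on `φ`. -/
def IsMorphism [T2Space T] (F : SubgroupCategory S) (G : SubgroupCategory T) (α : S →ₜ* T) :
    Prop :=
  ∀ (P Q : ClosedSubgroup S), ∀ φ ∈ F.Hom P Q, ∃ ψ ∈ G.Hom (P.image α) (Q.image α),
    ∀ a : P, (ψ ⟨α a, P.apply_mem_image α a⟩ : T) = α (φ a)

/-- `F` and `G` are isomorphic: there is an isomorphism of topological groups `S ≃ T` which is,
with its inverse, a morphism between `F` and `G`. -/
def IsIsomorphic [T2Space S] [T2Space T] (F : SubgroupCategory S) (G : SubgroupCategory T) :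
    Prop :=
  ∃ e : S ≃ₜ* T, IsMorphism F G (e : S →ₜ* T) ∧ IsMorphism G F (e.symm : T →ₜ* S)

end Morphisms

end SubgroupCategory

/-- An inverse system, indexed by `I`, of fusion systems `fus i` on finite (discrete) `p`-groups
`grp i`, with transition morphisms `map : fus j → fus i` for `i ≤ j`. -/
structure FusionInverseSystem (p : ℕ) (I : Type w) [PartialOrder I] where
  grp : I → Type v
  [group : ∀ i, Group (grp i)]
  [topologicalSpace : ∀ i, TopologicalSpace (grp i)]
  [discreteTopology : ∀ i, DiscreteTopology (grp i)]
  [finite : ∀ i, Finite (grp i)]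
  isPGroup : ∀ i, IsPGroup p (grp i)
  fus : ∀ i, SubgroupCategory (grp i)
  isFusionSystem : ∀ i, (fus i).IsFusionSystem
  map : ∀ {i j : I}, i ≤ j → (grp j →ₜ* grp i)
  map_id : ∀ (i : I) (a : grp i), map (le_refl i) a = a
  map_comp : ∀ {i j k : I} (hij : i ≤ j) (hjk : j ≤ k) (a : grp k),
    map hij (map hjk a) = map (hij.trans hjk) a
  isMorphism : ∀ {i j : I} (hij : i ≤ j),
    SubgroupCategory.IsMorphism (fus j) (fus i) (map hij)

attribute [instance] FusionInverseSystem.group FusionInverseSystem.topologicalSpace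
  FusionInverseSystem.discreteTopology FusionInverseSystem.finite

namespace FusionInverseSystem

variable {p : ℕ} {I : Type w} [PartialOrder I] (D : FusionInverseSystem.{v, w} p I)

/-- The inverse limit of the groups `D.grp i`, as a subgroup of their product. -/
def limSubgroup : Subgroup (∀ i, D.grp i) where
  carrier := {a | ∀ (i j : I) (hij : i ≤ j), D.map hij (a j) = a i}
  one_mem' := fun i j hij => by simp
  mul_mem' := fun {a b} ha hb i j hij => by simp [ha i j hij, hb i j hij]
  inv_mem' := fun {a} ha i j hij => by simp [ha i j hij]

/-- The inverse limit group, with the topology induced by the product topology. -/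
abbrev Lim : Type (max v w) := D.limSubgroup

theorem isClosed_limSubgroup : IsClosed (D.limSubgroup : Set (∀ i, D.grp i)) := by
  have h : (D.limSubgroup : Set (∀ i, D.grp i)) =
      ⋂ (i : I) (j : I) (hij : i ≤ j), {a | D.map hij (a j) = a i} := by
    ext a
    simp only [Set.mem_iInter, Set.mem_ofPred_eq]
    rfl
  rw [h]
  refine isClosed_iInter fun i => isClosed_iInter fun j => isClosed_iInter fun hij => ?_
  exact isClosed_eq ((D.map hij).continuous_toFun.comp (continuous_apply j)) (continuous_apply i)

instance instCompactSpaceLim : CompactSpace D.Lim :=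
  isCompact_iff_compactSpace.mp D.isClosed_limSubgroup.isCompact

/-- The projection from the limit group to `D.grp i`. -/
def proj (i : I) : D.Lim →ₜ* D.grp i where
  toMonoidHom := (Pi.evalMonoidHom D.grp i).comp D.limSubgroup.subtype
  continuous_toFun := (continuous_apply i).comp continuous_subtype_val

/-- The inverse limit of the system, on the group `D.Lim`. A compatible family of morphisms
`f i` in `Hom (proj i P) (proj i Q)` is the same thing as a homomorphism `φ : P → Q` inducing a
morphism of `D.fus i` for each `i` (the `f i` are then unique, and compatible, since
`P → proj i P` is onto; see also `existsUnique_of_compatible` for the converse). -/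
def lim : SubgroupCategory D.Lim where
  Hom P Q := {φ | ∀ i, ∃ f ∈ (D.fus i).Hom (P.image (D.proj i)) (Q.image (D.proj i)),
    ∀ a : P, (f ⟨D.proj i a, P.apply_mem_image _ a⟩ : D.grp i) = D.proj i (φ a)}
  id_mem P i := ⟨_, (D.fus i).id_mem _, fun _ => rfl⟩
  comp_mem := by
    intro P Q R φ ψ hφ hψ i
    obtain ⟨f, hf, hfφ⟩ := hφ i
    obtain ⟨g, hg, hgψ⟩ := hψ i
    refine ⟨g.comp f, (D.fus i).comp_mem hf hg, fun a => ?_⟩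
    have h : f ⟨D.proj i a, P.apply_mem_image _ a⟩ =
        ⟨D.proj i (φ a), Q.apply_mem_image _ (φ a)⟩ := Subtype.ext (hfφ a)
    change (g (f _) : D.grp i) = D.proj i (ψ (φ a))
    rw [h, hgψ]

/-- Each element of the inverse limit of the sets `Hom (proj i P) (proj i Q)` comes from exactly
one morphism of `D.lim`. -/
theorem existsUnique_of_compatible [Nonempty I] [IsDirectedOrder I] (P Q : ClosedSubgroup D.Lim)
    (f : ∀ i, P.image (D.proj i) →ₜ* Q.image (D.proj i))
    (hf : ∀ i, f i ∈ (D.fus i).Hom (P.image (D.proj i)) (Q.image (D.proj i)))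
    (hc : ∀ (i j : I) (hij : i ≤ j) (a : P.image (D.proj i)) (b : P.image (D.proj j)),
      (a : D.grp i) = D.map hij b → (f i a : D.grp i) = D.map hij (f j b)) :
    ∃! φ : P →ₜ* Q, φ ∈ D.lim.Hom P Q ∧
      ∀ i, ∀ a : P, (f i ⟨D.proj i a, P.apply_mem_image _ a⟩ : D.grp i) = D.proj i (φ a) := by
  let y : P → ∀ i, D.grp i := fun a i => f i ⟨D.proj i a, P.apply_mem_image _ a⟩
  have hy : ∀ a, y a ∈ D.limSubgroup := fun a i j hij =>
    (hc i j hij _ _ (a.1.2 i j hij).symm).symm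
  have hyQ : ∀ a, (⟨y a, hy a⟩ : D.Lim) ∈ Q := by
    intro a
    have hQ : IsClosed (Q : Set D.Lim) := Q.isClosed'
    change _ ∈ (Q : Set D.Lim)
    rw [← hQ.closure_eq, mem_closure_iff_nhds]
    intro t ht
    rw [mem_nhds_subtype] at ht
    obtain ⟨u, hu, hut⟩ := ht
    rw [nhds_pi, Filter.mem_pi] at hu
    obtain ⟨K, hK, V, hV, hVu⟩ := hu
    obtain ⟨k, hk⟩ := hK.toFinset.exists_le
    obtain ⟨q, hq, hqk⟩ := (f k ⟨D.proj k a, P.apply_mem_image _ a⟩).2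
    refine ⟨q, hut (hVu fun i hi => ?_), hq⟩
    have hik := hk i (hK.mem_toFinset.2 hi)
    have : q.1 i = y a i := by
      rw [← q.2 i k hik, ← hy a i k hik]
      exact congrArg _ hqk
    rw [this]
    exact mem_of_mem_nhds (hV i)
  let φ : P →ₜ* Q :=
    { toFun := fun a => ⟨⟨y a, hy a⟩, hyQ a⟩
      map_one' := by
        apply Subtype.ext; apply Subtype.ext; funext i
        exact congrArg Subtype.val (map_one (f i))
      map_mul' := fun a b => by
        apply Subtype.ext; apply Subtype.ext; funext i
        exact congrArg Subtype.val (map_mul (f i) ⟨D.proj i a, P.apply_mem_image _ a⟩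
          ⟨D.proj i b, P.apply_mem_image _ b⟩)
      continuous_toFun := by
        refine Continuous.subtype_mk (Continuous.subtype_mk (continuous_pi fun i => ?_) _) _
        exact continuous_subtype_val.comp ((f i).continuous_toFun.comp
          (Continuous.subtype_mk ((D.proj i).continuous_toFun.comp continuous_subtype_val) _)) }
  refine ⟨φ, ⟨fun i => ⟨f i, hf i, fun _ => rfl⟩, fun _ _ => rfl⟩, ?_⟩
  rintro ψ ⟨-, hψ⟩
  ext a i
  exact (hψ i a).symm

end FusionInverseSystem

namespace SubgroupCategory

variable {S : Type u} [Group S] [TopologicalSpace S] [CompactSpace S] [T2Space S]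

/-- `F` is countably based: it is isomorphic to the inverse limit of a system of fusion systems
on finite `p`-groups indexed by the natural numbers. -/
def IsCountablyBased (p : ℕ) (F : SubgroupCategory S) : Prop :=
  ∃ D : FusionInverseSystem.{v, 0} p ℕ, IsIsomorphic F D.lim

/-- `F` is pro-saturated: it is isomorphic to the inverse limit of a system of saturated fusion
systems on finite `p`-groups indexed by a directed set. -/
def IsProSaturated (p : ℕ) (F : SubgroupCategory S) : Prop :=
  ∃ (I : Type w) (_ : PartialOrder I) (_ : Nonempty I) (_ : IsDirectedOrder I)
    (D : FusionInverseSystem.{v, w} p I), (∀ i, (D.fus i).IsSaturated p) ∧ IsIsomorphic F D.lim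

end SubgroupCategory

/-!
Write `F` as a limit of saturated fusion systems `F i` on finite groups, with projections `f i`, and
regard a morphism as its graph, a closed subgroup of `S × S`. A compactness argument shows that a
family of morphisms of the `F i` has a limit along each ultrafilter on the index set, and that it is
a morphism of `F`.

By compactness again, each subgroup of `S` has an `F`-conjugate `Q` whose normalizer is maximal:
a morphism of `F` defined on `N_S(Q)` maps it onto the normalizer of the image of `Q`. At level `i`
the image of `Q` is mapped onto a fully normalized subgroup `B i` by a morphism defined on the
normalizer of that image. Let `χ`, defined on `N_S(Q)`, be the limit of these morphisms.

* `Q` is receptive: given `φ : R → Q`, extend the composite `f i (R) → f i (Q) → B i` at each level,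
  take the limit, and compose with `χ⁻¹`. By maximality of the normalizer, the limit maps `N_φ` into
  the domain of `χ⁻¹`.
* `Q` is fully automized: for an open normal subgroup `V` of `Aut_F(Q)`, maximality of the
  normalizer shows that, at some large level `i`, the inner automorphisms of `B i`, transported to
  the image of `Q` and then to a lower level, come from `Aut_S(Q)`. Hence the index of `Aut_S(Q) V`
  divides that of the Sylow subgroup of inner automorphisms of `B i`.
-/

local notation "𝐍(" P ")" => Subgroup.normalizer (SetLike.coe P)

/-- A multivalued partial homomorphism from `G` to `H`: a relation that is a subgroup of `G × H`.
Morphisms between subgroups are replaced with their graphs, as these can be compared without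
transport along equalities of subgroups, and pass to limits as subgroups. -/
abbrev GroupRel (G H : Type*) [Group G] [Group H] : Type _ :=
  Subgroup (G × H)

namespace GroupRel

section Operations

variable {G H K : Type*} [Group G] [Group H] [Group K]

/-- The domain of a relation. -/
def dom (Γ : GroupRel G H) : Subgroup G :=
  Γ.map (MonoidHom.fst G H)

/-- The range of a relation. -/
def ran (Γ : GroupRel G H) : Subgroup H :=
  Γ.map (MonoidHom.snd G H)

/-- The converse of a relation. -/
def inv (Γ : GroupRel G H) : GroupRel H G :=
  Γ.comap (MulEquiv.prodComm : H × G ≃* G × H).toMonoidHom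

/-- The composite of two relations, in diagrammatic order. -/
def comp (Γ : GroupRel G H) (Δ : GroupRel H K) : GroupRel G K where
  carrier := {z | ∃ y, (z.1, y) ∈ Γ ∧ (y, z.2) ∈ Δ}
  one_mem' := ⟨1, one_mem Γ, one_mem Δ⟩
  mul_mem' := by
    rintro _ _ ⟨y, h, h'⟩ ⟨z, k, k'⟩
    exact ⟨y * z, mul_mem h k, mul_mem h' k'⟩
  inv_mem' := by
    rintro _ ⟨y, h, h'⟩
    exact ⟨y⁻¹, inv_mem h, inv_mem h'⟩

/-- The restriction of a relation to a subgroup of its source. -/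
def restrict (Γ : GroupRel G H) (P : Subgroup G) : GroupRel G H :=
  Γ ⊓ P.comap (MonoidHom.fst G H)

/-- The relation between the elements of `P` and their conjugates by `s`. -/
def conj (P : Subgroup G) (s : G) : GroupRel G G :=
  P.map ((MonoidHom.id G).prod (MulAut.conj s).toMonoidHom)

/-- The image of a relation on `G` under a homomorphism, applied to both components. -/
abbrev image (f : G →* H) (Γ : GroupRel G G) : GroupRel H H :=
  Γ.map (f.prodMap f)

/-- The relation `Γ` is single-valued. -/
def IsFunctional (Γ : GroupRel G H) : Prop :=
  ∀ y, (1, y) ∈ Γ → y = 1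

variable {Γ : GroupRel G H} {Δ : GroupRel H K}

theorem mem_dom {a : G} : a ∈ Γ.dom ↔ ∃ b, (a, b) ∈ Γ := by
  simp [dom]

theorem mem_ran {b : H} : b ∈ Γ.ran ↔ ∃ a, (a, b) ∈ Γ := by
  simp [ran]

theorem mem_inv {a : G} {b : H} : (b, a) ∈ Γ.inv ↔ (a, b) ∈ Γ :=
  Iff.rfl

theorem mem_comp {a : G} {c : K} : (a, c) ∈ Γ.comp Δ ↔ ∃ b, (a, b) ∈ Γ ∧ (b, c) ∈ Δ :=
  Iff.rfl

theorem mem_restrict {P : Subgroup G} {a : G} {b : H} :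
    (a, b) ∈ Γ.restrict P ↔ (a, b) ∈ Γ ∧ a ∈ P :=
  Iff.rfl

theorem mem_conj {P : Subgroup G} {s a b : G} :
    (a, b) ∈ conj P s ↔ a ∈ P ∧ b = s * a * s⁻¹ := by
  simp [conj, Prod.ext_iff, eq_comm]

theorem mem_image {f : G →* H} {Γ : GroupRel G G} {x y : H} :
    (x, y) ∈ Γ.image f ↔ ∃ a b, (a, b) ∈ Γ ∧ f a = x ∧ f b = y := by
  simp [image, Subgroup.mem_map]

theorem dom_inv : Γ.inv.dom = Γ.ran := by
  ext; simp only [mem_dom, mem_ran, mem_inv]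

theorem ran_inv : Γ.inv.ran = Γ.dom := by
  ext; simp only [mem_dom, mem_ran, mem_inv]

theorem dom_comp (h : Γ.ran ≤ Δ.dom) : (Γ.comp Δ).dom = Γ.dom := by
  ext a
  simp only [mem_dom, mem_comp]
  refine ⟨fun ⟨_, b, hab, _⟩ => ⟨b, hab⟩, fun ⟨b, hab⟩ => ?_⟩
  obtain ⟨c, hbc⟩ := mem_dom.1 (h (mem_ran.2 ⟨a, hab⟩))
  exact ⟨c, b, hab, hbc⟩

theorem ran_comp (h : Δ.dom ≤ Γ.ran) : (Γ.comp Δ).ran = Δ.ran := by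
  ext c
  simp only [mem_ran, mem_comp]
  refine ⟨fun ⟨_, b, _, hbc⟩ => ⟨b, hbc⟩, fun ⟨b, hbc⟩ => ?_⟩
  obtain ⟨a, hab⟩ := mem_ran.1 (h (mem_dom.2 ⟨c, hbc⟩))
  exact ⟨a, b, hab, hbc⟩

theorem dom_restrict {P : Subgroup G} (h : P ≤ Γ.dom) : (Γ.restrict P).dom = P := by
  ext a
  simp only [mem_dom, mem_restrict]
  exact ⟨fun ⟨_, _, ha⟩ => ha, fun ha => (mem_dom.1 (h ha)).imp fun _ hab => ⟨hab, ha⟩⟩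

theorem restrict_le (Γ : GroupRel G H) (P : Subgroup G) : Γ.restrict P ≤ Γ :=
  inf_le_left

theorem dom_mono {Γ' : GroupRel G H} (h : Γ ≤ Γ') : Γ.dom ≤ Γ'.dom :=
  Subgroup.map_mono h

theorem dom_image (f : G →* H) (Γ : GroupRel G G) : (Γ.image f).dom = Γ.dom.map f := by
  rw [dom, dom, image, Subgroup.map_map, Subgroup.map_map]
  rfl

theorem ran_image (f : G →* H) (Γ : GroupRel G G) : (Γ.image f).ran = Γ.ran.map f := by
  rw [ran, ran, image, Subgroup.map_map, Subgroup.map_map]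
  rfl

theorem image_id (Γ : GroupRel G G) : Γ.image (MonoidHom.id G) = Γ :=
  Subgroup.map_id Γ

theorem image_image (f : G →* H) (f' : H →* K) (Γ : GroupRel G G) :
    (Γ.image f).image f' = Γ.image (f'.comp f) :=
  Subgroup.map_map Γ _ _

theorem inv_image (f : G →* H) (Γ : GroupRel G G) : (Γ.image f).inv = Γ.inv.image f := by
  ext ⟨x, y⟩
  simp only [mem_inv, mem_image]
  rw [exists_comm]
  simp only [and_comm]

theorem dom_conj (P : Subgroup G) (s : G) : (conj P s).dom = P := by
  ext; simp [mem_dom, mem_conj]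

theorem ran_conj {P : Subgroup G} {s : G} (hs : s ∈ 𝐍(P)) : (conj P s).ran = P := by
  refine Subgroup.ext fun b => ⟨fun hb => ?_, fun hb => mem_ran.2 ⟨s⁻¹ * b * s, mem_conj.2 ?_⟩⟩
  · obtain ⟨a, hab⟩ := mem_ran.1 hb
    obtain ⟨ha, rfl⟩ := mem_conj.1 hab
    exact (hs a).1 ha
  · refine ⟨(hs _).2 ?_, by group⟩
    rwa [show s * (s⁻¹ * b * s) * s⁻¹ = b by group]

theorem IsFunctional.eq (hΓ : Γ.IsFunctional) {a : G} {b b' : H} (h : (a, b) ∈ Γ)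
    (h' : (a, b') ∈ Γ) : b = b' := by
  have := hΓ (b * b'⁻¹) (by simpa using mul_mem h (inv_mem h'))
  rwa [mul_inv_eq_one] at this

theorem IsFunctional.restrict_dom_of_le {Γ' : GroupRel G H} (hΓ' : Γ'.IsFunctional) (h : Γ ≤ Γ') :
    Γ'.restrict Γ.dom = Γ := by
  refine le_antisymm ?_ fun z hz => ⟨h hz, Subgroup.mem_map_of_mem _ hz⟩
  rintro ⟨a, b⟩ ⟨hab, ha⟩
  obtain ⟨b', hab'⟩ := mem_dom.1 ha
  rwa [hΓ'.eq hab (h hab')]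

end Operations

section Normalizer

variable {G H K : Type*} [Group G] [Group H] [Group K] {Γ : GroupRel G H} {Δ : GroupRel H K}
  {a : G} {b : H} {c : K}

theorem mem_normalizer_dom (h : (a, b) ∈ 𝐍(Γ)) : a ∈ 𝐍(Γ.dom) :=
  Subgroup.le_normalizer_map (MonoidHom.fst G H) (Subgroup.mem_map_of_mem _ h)

theorem mem_normalizer_ran (h : (a, b) ∈ 𝐍(Γ)) : b ∈ 𝐍(Γ.ran) :=
  Subgroup.le_normalizer_map (MonoidHom.snd G H) (Subgroup.mem_map_of_mem _ h)

theorem mem_normalizer_comp (hab : (a, b) ∈ 𝐍(Γ)) (hbc : (b, c) ∈ 𝐍(Δ)) :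
    (a, c) ∈ 𝐍(Γ.comp Δ) := by
  rintro ⟨x, z⟩
  refine ⟨fun ⟨y, hxy, hyz⟩ => ⟨b * y * b⁻¹, (hab (x, y)).1 hxy, (hbc (y, z)).1 hyz⟩,
    fun ⟨y, hxy, hyz⟩ => ⟨b⁻¹ * y * b, (hab (x, _)).2 ?_, (hbc (_, z)).2 ?_⟩⟩
  · simpa [mul_assoc] using hxy
  · simpa [mul_assoc] using hyz

theorem mem_normalizer_restrict {P : Subgroup G} (hab : (a, b) ∈ Γ) (ha : a ∈ 𝐍(P)) :
    (a, b) ∈ 𝐍(Γ.restrict P) := fun z =>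
  and_congr (Subgroup.le_normalizer (H := Γ) hab z) (ha z.1)

theorem mem_normalizer_of_le {Γ' : GroupRel G H} (hΓ' : Γ'.IsFunctional) (h : Γ ≤ Γ')
    (hab : (a, b) ∈ Γ') (ha : a ∈ 𝐍(Γ.dom)) : (a, b) ∈ 𝐍(Γ) := by
  rw [← hΓ'.restrict_dom_of_le h]
  exact mem_normalizer_restrict hab ha

theorem mem_normalizer_of_forall (hΓ : Γ.IsFunctional) (ha : a ∈ 𝐍(Γ.dom))
    (h : ∀ ⦃x y⦄, (x, y) ∈ Γ → (a * x * a⁻¹, b * y * b⁻¹) ∈ Γ) : (a, b) ∈ 𝐍(Γ) := by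
  rintro ⟨x, y⟩
  refine ⟨fun hxy => h hxy, fun hxy => ?_⟩
  obtain ⟨y', hxy'⟩ := mem_dom.1 ((ha x).2 (mem_dom.2 ⟨_, hxy⟩))
  have hy : b * y' * b⁻¹ = b * y * b⁻¹ := hΓ.eq (h hxy') hxy
  rwa [← mul_left_cancel (mul_right_cancel hy)]

end Normalizer

section Topology

variable {G H : Type*} [Group G] [TopologicalSpace G] [Group H] [TopologicalSpace H]
  {Γ : GroupRel G H}

theorem isClosed_inv (hΓ : IsClosed (Γ : Set (G × H))) : IsClosed (Γ.inv : Set (H × G)) :=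
  hΓ.preimage continuous_swap

theorem isClosed_restrict (hΓ : IsClosed (Γ : Set (G × H))) {P : Subgroup G}
    (hP : IsClosed (P : Set G)) : IsClosed (Γ.restrict P : Set (G × H)) :=
  hΓ.inter (hP.preimage continuous_fst)

theorem isClosed_dom [CompactSpace H] (hΓ : IsClosed (Γ : Set (G × H))) :
    IsClosed (Γ.dom : Set G) :=
  isClosedMap_fst_of_compactSpace _ hΓ

theorem isClosed_ran [CompactSpace G] (hΓ : IsClosed (Γ : Set (G × H))) :
    IsClosed (Γ.ran : Set H) :=
  isClosedMap_snd_of_compactSpace _ hΓ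

end Topology

section Graph

variable {S : Type u} [Group S] [TopologicalSpace S] {P Q : ClosedSubgroup S}

/-- The graph of a homomorphism between closed subgroups of `S`. -/
def graph (φ : P →ₜ* Q) : GroupRel S S :=
  (P.toSubgroup.subtype.prod (Q.toSubgroup.subtype.comp φ.toMonoidHom)).range

theorem mem_graph {φ : P →ₜ* Q} {x y : S} :
    (x, y) ∈ graph φ ↔ ∃ a : P, (a : S) = x ∧ (φ a : S) = y :=
  exists_congr fun _ => Prod.ext_iff

theorem apply_mem_graph (φ : P →ₜ* Q) (a : P) : ((a : S), (φ a : S)) ∈ graph φ :=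
  mem_graph.2 ⟨a, rfl, rfl⟩

theorem apply_eq_of_mem_graph {φ : P →ₜ* Q} {a : P} {y : S} (h : ((a : S), y) ∈ graph φ) :
    (φ a : S) = y := by
  obtain ⟨b, hb, hby⟩ := mem_graph.1 h
  rwa [← show b = a from Subtype.ext hb]

theorem mem_graph_iff {φ : P →ₜ* Q} {x y : S} :
    (x, y) ∈ graph φ ↔ ∃ hx : x ∈ P, (φ ⟨x, hx⟩ : S) = y := by
  rw [mem_graph]
  exact ⟨fun ⟨a, hax, hay⟩ => by subst hax; exact ⟨a.2, hay⟩, fun ⟨hx, hy⟩ => ⟨⟨x, hx⟩, rfl, hy⟩⟩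

theorem graph_injective {φ ψ : P →ₜ* Q} (h : graph φ = graph ψ) : φ = ψ :=
  ContinuousMonoidHom.ext fun a =>
    Subtype.ext (apply_eq_of_mem_graph (h ▸ apply_mem_graph ψ a))

theorem dom_graph (φ : P →ₜ* Q) : (graph φ).dom = P.toSubgroup := by
  ext x
  simp only [mem_dom, mem_graph_iff]
  exact ⟨fun ⟨_, hx, _⟩ => hx, fun hx => ⟨_, hx, rfl⟩⟩

theorem ran_graph_le (φ : P →ₜ* Q) : (graph φ).ran ≤ Q.toSubgroup := by
  intro y hy
  obtain ⟨x, hxy⟩ := mem_ran.1 hy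
  obtain ⟨hx, rfl⟩ := mem_graph_iff.1 hxy
  exact (φ ⟨x, hx⟩).2

theorem isFunctional_graph (φ : P →ₜ* Q) : (graph φ).IsFunctional := by
  intro y hy
  rw [← apply_eq_of_mem_graph (a := 1) hy, map_one]
  rfl

theorem isClosed_graph [CompactSpace S] [T2Space S] (φ : P →ₜ* Q) :
    IsClosed (graph φ : Set (S × S)) := by
  have hP : CompactSpace P := isCompact_iff_compactSpace.mp P.isClosed'.isCompact
  have hcont : Continuous fun a : P => ((a : S), (φ a : S)) :=
    continuous_subtype_val.prodMk (continuous_subtype_val.comp φ.continuous_toFun)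
  exact (isCompact_range hcont).isClosed

theorem graph_inv {φ : P →ₜ* Q} {ψ : Q →ₜ* P} (hψφ : ∀ a, ψ (φ a) = a) (hφψ : ∀ b, φ (ψ b) = b) :
    graph ψ = (graph φ).inv := by
  ext ⟨y, x⟩
  rw [mem_inv, mem_graph, mem_graph]
  constructor
  · rintro ⟨b, rfl, rfl⟩
    exact ⟨ψ b, rfl, by rw [hφψ]⟩
  · rintro ⟨a, rfl, rfl⟩
    exact ⟨φ a, rfl, by rw [hψφ]⟩

theorem graph_comp {R : ClosedSubgroup S} (φ : P →ₜ* Q) (ψ : Q →ₜ* R) :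
    graph (ψ.comp φ) = (graph φ).comp (graph ψ) := by
  ext ⟨x, z⟩
  rw [mem_comp, mem_graph]
  constructor
  · rintro ⟨a, rfl, rfl⟩
    exact ⟨φ a, apply_mem_graph φ a, apply_mem_graph ψ (φ a)⟩
  · rintro ⟨y, hxy, hyz⟩
    obtain ⟨a, rfl, rfl⟩ := mem_graph.1 hxy
    exact ⟨a, rfl, apply_eq_of_mem_graph (φ := ψ) hyz⟩

theorem apply_eq_of_graph_eq {P' Q' : ClosedSubgroup S} {φ : P →ₜ* Q} {ψ : P' →ₜ* Q'}
    (h : graph φ ≤ graph ψ) {a : P} {b : P'} (hab : (b : S) = a) : (ψ b : S) = φ a :=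
  apply_eq_of_mem_graph (hab ▸ h (apply_mem_graph φ a))

variable [CompactSpace S]

theorem graph_eq_image {T : Type v} [Group T] [TopologicalSpace T] [T2Space T] (α : S →ₜ* T)
    {φ : P →ₜ* Q} {ψ : P.image α →ₜ* Q.image α}
    (h : ∀ a : P, (ψ ⟨α a, P.apply_mem_image α a⟩ : T) = α (φ a)) :
    graph ψ = (graph φ).image α := by
  ext ⟨x, y⟩
  rw [mem_image, mem_graph_iff]
  constructor
  · rintro ⟨⟨a, ha, rfl⟩, rfl⟩
    exact ⟨a, φ ⟨a, ha⟩, apply_mem_graph φ ⟨a, ha⟩, rfl, (h ⟨a, ha⟩).symm⟩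
  · rintro ⟨a, b, hab, rfl, rfl⟩
    obtain ⟨ha, rfl⟩ := mem_graph_iff.1 hab
    exact ⟨P.apply_mem_image α ⟨a, ha⟩, h ⟨a, ha⟩⟩

theorem exists_graph_eq {Γ : GroupRel S S} (hΓ : IsClosed (Γ : Set (S × S)))
    (hf : Γ.IsFunctional) (hP : Γ.dom = P.toSubgroup) (hQ : Γ.ran ≤ Q.toSubgroup) :
    ∃ φ : P →ₜ* Q, graph φ = Γ := by
  have hdom : ∀ a : P, ∃ y, ((a : S), y) ∈ Γ := fun a => mem_dom.1 (hP ▸ a.2)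
  choose f hfΓ using hdom
  have hfQ : ∀ a, f a ∈ Q := fun a => hQ (mem_ran.2 ⟨a, hfΓ a⟩)
  let φ : P →ₜ* Q :=
    { toFun := fun a => ⟨f a, hfQ a⟩
      map_one' := Subtype.ext (hf.eq (hfΓ 1) (one_mem Γ))
      map_mul' := fun a b => Subtype.ext (hf.eq (hfΓ (a * b)) (mul_mem (hfΓ a) (hfΓ b)))
      continuous_toFun := by
        refine Continuous.subtype_mk (continuous_iff_isClosed.2 fun C hC => ?_) _
        have himg : IsClosed (Prod.fst '' ((Γ : Set (S × S)) ∩ Prod.snd ⁻¹' C)) :=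
          isClosedMap_fst_of_compactSpace _ (hΓ.inter (hC.preimage continuous_snd))
        convert himg.preimage (continuous_subtype_val (p := (· ∈ P))) using 1
        ext a
        constructor
        · exact fun ha => ⟨(a, f a), ⟨hfΓ a, ha⟩, rfl⟩
        · rintro ⟨⟨x, y⟩, ⟨hxy, hy⟩, rfl⟩
          rw [Set.mem_preimage, hf.eq (hfΓ a) hxy]
          exact hy }
  refine ⟨φ, le_antisymm ?_ ?_⟩
  · rintro _ ⟨a, rfl⟩
    exact hfΓ a
  · rintro ⟨x, y⟩ hxy
    have hx : x ∈ P := by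
      change x ∈ P.toSubgroup
      exact hP ▸ mem_dom.2 ⟨y, hxy⟩
    exact mem_graph_iff.2 ⟨hx, hf.eq (hfΓ ⟨x, hx⟩) hxy⟩

end Graph

end GroupRel

theorem exists_eventually_eq_of_finite {A X : Type*} [Finite X] (U : Ultrafilter A) (f : A → X) :
    ∃ x, ∀ᶠ a in U, f a = x := by
  obtain ⟨x, hx⟩ := Ultrafilter.eq_pure_of_finite (U.map f)
  exact ⟨x, show {x} ∈ U.map f from hx ▸ Ultrafilter.mem_pure.2 rfl⟩

/-- The topological group `G` is, by means of the maps `g i`, the inverse limit of the discrete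
groups `H i` with the transition maps `t i j`. -/
structure IsGroupLimit {I : Type*} [Preorder I] {G : Type*} [Group G] [TopologicalSpace G]
    {H : I → Type*} [∀ i, Group (H i)] [∀ i, TopologicalSpace (H i)]
    (t : ∀ i j : I, i ≤ j → H j →* H i) (g : ∀ i, G →* H i) : Prop where
  discreteTopology : ∀ i, DiscreteTopology (H i)
  continuous : ∀ i, Continuous (g i)
  map_apply : ∀ {i j : I} (hij : i ≤ j) (a : G), t i j hij (g j a) = g i a
  map_map : ∀ {i j k : I} (hij : i ≤ j) (hjk : j ≤ k) (a : H k),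
    t i j hij (t j k hjk a) = t i k (hij.trans hjk) a
  eq_one : ∀ a : G, (∀ i, g i a = 1) → a = 1
  exists_of_compatible : ∀ a : ∀ i, H i, (∀ (i j : I) (hij : i ≤ j), t i j hij (a j) = a i) →
    ∃ b, ∀ i, g i b = a i

/-- The subgroup `Γ` of the inverse limit `G` is the limit, along the ultrafilter `U`, of the
subgroups `Λ a` of the groups `H (ℓ a)`: at each level `i`, the image of `Γ` agrees with that of
`Λ a` for `U`-almost all `a`. The `Λ a` need not be compatible with the transition maps. -/
def IsLevelLimit {I : Type*} [Preorder I] {G : Type*} [Group G] {H : I → Type*} [∀ i, Group (H i)]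
    (t : ∀ i j : I, i ≤ j → H j →* H i) (g : ∀ i, G →* H i) {A : Type*} {ℓ : A → I}
    (U : Ultrafilter A) (Γ : Subgroup G) (Λ : ∀ a, Subgroup (H (ℓ a))) : Prop :=
  ∀ i, ∀ᶠ a in U, ∃ hi : i ≤ ℓ a, Γ.map (g i) = (Λ a).map (t i (ℓ a) hi)

/-- The relation `Γ` on an inverse limit is the limit, in the sense of `IsLevelLimit`, of the
relations `Λ a`. -/
def IsRelLevelLimit {I : Type*} [Preorder I] {G : Type*} [Group G] {H : I → Type*}
    [∀ i, Group (H i)] (t : ∀ i j : I, i ≤ j → H j →* H i) (g : ∀ i, G →* H i) {A : Type*}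
    {ℓ : A → I} (U : Ultrafilter A) (Γ : GroupRel G G)
    (Λ : ∀ a, GroupRel (H (ℓ a)) (H (ℓ a))) : Prop :=
  IsLevelLimit (fun i j hij => (t i j hij).prodMap (t i j hij)) (fun i => (g i).prodMap (g i)) U Γ Λ

namespace IsGroupLimit

variable {I : Type*} [Preorder I] {G : Type*} [Group G] [TopologicalSpace G]
  {H : I → Type*} [∀ i, Group (H i)] [∀ i, TopologicalSpace (H i)]
  {t : ∀ i j : I, i ≤ j → H j →* H i} {g : ∀ i, G →* H i}

theorem prod (h : IsGroupLimit t g) :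
    IsGroupLimit (G := G × G) (fun i j hij => (t i j hij).prodMap (t i j hij))
      (fun i => (g i).prodMap (g i)) where
  discreteTopology i := have := h.discreteTopology i; inferInstance
  continuous i := (h.continuous i).prodMap (h.continuous i)
  map_apply hij a := Prod.ext (h.map_apply hij _) (h.map_apply hij _)
  map_map hij hjk a := Prod.ext (h.map_map hij hjk _) (h.map_map hij hjk _)
  eq_one a ha := Prod.ext (h.eq_one _ fun i => congrArg Prod.fst (ha i))
    (h.eq_one _ fun i => congrArg Prod.snd (ha i))
  exists_of_compatible a ha := by
    obtain ⟨b, hb⟩ := h.exists_of_compatible (fun i => (a i).1)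
      fun i j hij => congrArg Prod.fst (ha i j hij)
    obtain ⟨c, hc⟩ := h.exists_of_compatible (fun i => (a i).2)
      fun i j hij => congrArg Prod.snd (ha i j hij)
    exact ⟨(b, c), fun i => Prod.ext (hb i) (hc i)⟩

variable (h : IsGroupLimit t g)
include h

theorem map_comp_eq {i j : I} (hij : i ≤ j) : (t i j hij).comp (g j) = g i :=
  MonoidHom.ext (h.map_apply hij)

theorem map_map_eq {i j : I} (hij : i ≤ j) (Γ : Subgroup G) :
    (Γ.map (g j)).map (t i j hij) = Γ.map (g i) := by
  rw [Subgroup.map_map, h.map_comp_eq]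

theorem eq_of_forall {a b : G} (hab : ∀ i, g i a = g i b) : a = b := by
  refine mul_inv_eq_one.1 (h.eq_one _ fun i => ?_)
  rw [map_mul, map_inv, hab, mul_inv_cancel]

theorem isClosed_preimage (i : I) (A : Set (H i)) : IsClosed (g i ⁻¹' A) :=
  have := h.discreteTopology i
  (isClosed_discrete A).preimage (h.continuous i)

theorem isClosed_eqLocus (i : I) : IsClosed {z : G × G | g i z.1 = g i z.2} :=
  h.prod.isClosed_preimage i {z | z.1 = z.2}

theorem exists_forall_mem_of_subset [CompactSpace G] [Nonempty I] [IsDirectedOrder I]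
    {K W : Set G} (hK : IsClosed K) (hW : IsOpen W) (hKW : K ⊆ W) :
    ∃ i, ∀ a ∈ K, ∀ b, g i a = g i b → b ∈ W := by
  by_contra! hne
  let C : I → Set (G × G) := fun i => (K ×ˢ Wᶜ) ∩ {z | g i z.1 = g i z.2}
  have hC : ∀ i, IsClosed (C i) := fun i =>
    (hK.prod hW.isClosed_compl).inter (h.isClosed_eqLocus i)
  have hanti : ∀ {i j}, i ≤ j → C j ⊆ C i := fun hij z hz =>
    ⟨hz.1, show g _ z.1 = g _ z.2 by rw [← h.map_apply hij, hz.2, h.map_apply hij]⟩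
  have hdir : Directed (· ⊇ ·) C := fun i j =>
    (exists_ge_ge i j).imp fun _ hk => ⟨hanti hk.1, hanti hk.2⟩
  obtain ⟨z, hz⟩ := IsCompact.nonempty_iInter_of_directed_nonempty_isCompact_isClosed C hdir
    (fun i => have ⟨a, ha, b, hab, hb⟩ := hne i; ⟨(a, b), ⟨ha, hb⟩, hab⟩)
    (fun i => (hC i).isCompact) hC
  rw [Set.mem_iInter] at hz
  have hz₁₂ : z.1 = z.2 := h.eq_of_forall fun i => (hz i).2
  have hz' := (hz (Classical.arbitrary I)).1
  exact hz'.2 (hz₁₂ ▸ hKW hz'.1)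

theorem mem_of_forall [CompactSpace G] [Nonempty I] [IsDirectedOrder I] {Γ : Subgroup G}
    (hΓ : IsClosed (Γ : Set G)) {a : G} (ha : ∀ i, g i a ∈ Γ.map (g i)) : a ∈ Γ := by
  by_contra haΓ
  have hclosed : IsClosed {a} := by
    have : {a} = ⋂ i, g i ⁻¹' {g i a} := Set.ext fun b =>
      ⟨fun hb => by simp [Set.mem_singleton_iff.1 hb],
        fun hb => h.eq_of_forall fun i => Set.mem_iInter.1 hb i⟩
    exact this ▸ isClosed_iInter fun i => h.isClosed_preimage i _
  obtain ⟨i, hi⟩ := h.exists_forall_mem_of_subset hclosed hΓ.isOpen_compl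
    (Set.singleton_subset_iff.2 haΓ)
  obtain ⟨b, hb, hba⟩ := ha i
  exact hi a rfl b hba.symm hb

theorem le_of_forall [CompactSpace G] [Nonempty I] [IsDirectedOrder I] {Γ Δ : Subgroup G}
    (hΔ : IsClosed (Δ : Set G)) (hle : ∀ i, Γ.map (g i) ≤ Δ.map (g i)) : Γ ≤ Δ :=
  fun _ ha => h.mem_of_forall hΔ fun i => hle i (Subgroup.mem_map_of_mem _ ha)

section Ultrafilter

variable {A : Type*} {ℓ : A → I} {U : Ultrafilter A} (hU : Filter.Tendsto ℓ U Filter.atTop)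
include hU

theorem exists_levelLimit_apply [∀ i, Finite (H i)] (b : ∀ a, H (ℓ a)) :
    ∃ s : G, ∀ i, ∀ᶠ a in U, ∃ hi : i ≤ ℓ a, g i s = t i (ℓ a) hi (b a) := by
  classical
  choose c hc using fun i =>
    exists_eventually_eq_of_finite U fun a => if hi : i ≤ ℓ a then t i (ℓ a) hi (b a) else 1
  have hcb : ∀ i, ∀ᶠ a in U, ∃ hi : i ≤ ℓ a, t i (ℓ a) hi (b a) = c i := fun i => by
    filter_upwards [hc i, hU.eventually_ge_atTop i] with a ha hi
    exact ⟨hi, by rwa [dif_pos hi] at ha⟩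
  obtain ⟨s, hs⟩ := h.exists_of_compatible c fun i k hik => by
    obtain ⟨a, ⟨hi, hai⟩, hk, hak⟩ := ((hcb i).and (hcb k)).exists
    rw [← hak, h.map_map, hai]
  refine ⟨s, fun i => (hcb i).mono ?_⟩
  rintro a ⟨hi, ha⟩
  exact ⟨hi, by rw [hs, ha]⟩

theorem exists_isLevelLimit [∀ i, Finite (H i)] (Λ : ∀ a, Subgroup (H (ℓ a))) :
    ∃ Γ : Subgroup G, IsClosed (Γ : Set G) ∧ IsLevelLimit t g U Γ Λ := by
  classical
  choose L hL using fun i => exists_eventually_eq_of_finite U fun a =>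
    if hi : i ≤ ℓ a then (Λ a).map (t i (ℓ a) hi) else ⊥
  have hLΛ : ∀ i, ∀ᶠ a in U, ∃ hi : i ≤ ℓ a, (Λ a).map (t i (ℓ a) hi) = L i := fun i => by
    filter_upwards [hL i, hU.eventually_ge_atTop i] with a ha hi
    exact ⟨hi, by rwa [dif_pos hi] at ha⟩
  suffices hmap : ∀ i, (⨅ k, (L k).comap (g k)).map (g i) = L i by
    refine ⟨⨅ k, (L k).comap (g k), ?_, fun i => (hLΛ i).mono ?_⟩
    · simp only [Subgroup.coe_iInf, Subgroup.coe_comap]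
      exact isClosed_iInter fun i => h.isClosed_preimage i _
    · rintro a ⟨hi, ha⟩
      exact ⟨hi, by rw [hmap, ha]⟩
  refine fun i => le_antisymm (Subgroup.map_le_iff_le_comap.2 (iInf_le _ i)) fun x hx => ?_
  have hlift : ∀ a, ∃ b ∈ Λ a,
      ∀ hi : i ≤ ℓ a, (Λ a).map (t i (ℓ a) hi) = L i → t i (ℓ a) hi b = x := by
    intro a
    by_cases ha : ∃ hi : i ≤ ℓ a, (Λ a).map (t i (ℓ a) hi) = L i
    · obtain ⟨hi, ha⟩ := ha
      obtain ⟨b, hb, hbx⟩ := ha ▸ hx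
      exact ⟨b, hb, fun _ _ => hbx⟩
    · exact ⟨1, one_mem _, fun hi ha' => absurd ⟨hi, ha'⟩ ha⟩
  choose b hbΛ hbx using hlift
  obtain ⟨s, hs⟩ := h.exists_levelLimit_apply hU b
  refine ⟨s, Subgroup.mem_iInf.2 fun k => ?_, ?_⟩
  · obtain ⟨a, ⟨hk, hsa⟩, _, ha⟩ := ((hs k).and (hLΛ k)).exists
    rw [Subgroup.mem_comap, hsa, ← ha]
    exact Subgroup.mem_map_of_mem _ (hbΛ a)
  · obtain ⟨a, ⟨hi, hsa⟩, _, ha⟩ := ((hs i).and (hLΛ i)).exists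
    exact hsa.trans (hbx a hi ha)

theorem isLevelLimit_map (Γ : Subgroup G) :
    IsLevelLimit t g U Γ (fun a => Γ.map (g (ℓ a))) := fun i => by
  filter_upwards [hU.eventually_ge_atTop i] with a hi
  exact ⟨hi, (h.map_map_eq hi Γ).symm⟩

end Ultrafilter

section IsLevelLimit

variable {A : Type*} {ℓ : A → I} {U : Ultrafilter A} {Γ Γ' : Subgroup G}
  {Λ Λ' : ∀ a, Subgroup (H (ℓ a))}
  [CompactSpace G] [Nonempty I] [IsDirectedOrder I]

theorem le_of_isLevelLimit (hΓ' : IsClosed (Γ' : Set G)) (hlim : IsLevelLimit t g U Γ Λ)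
    (hlim' : IsLevelLimit t g U Γ' Λ') (hle : ∀ᶠ a in U, Λ a ≤ Λ' a) : Γ ≤ Γ' :=
  h.le_of_forall hΓ' fun i => by
    obtain ⟨a, ⟨hi, ha⟩, ⟨_, ha'⟩, hle⟩ := ((hlim i).and ((hlim' i).and hle)).exists
    rw [ha, ha']
    exact Subgroup.map_mono hle

theorem eq_of_isLevelLimit (hΓ : IsClosed (Γ : Set G)) (hΓ' : IsClosed (Γ' : Set G))
    (hlim : IsLevelLimit t g U Γ Λ) (hlim' : IsLevelLimit t g U Γ' Λ) : Γ = Γ' :=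
  (h.le_of_isLevelLimit hΓ' hlim hlim' (.of_forall fun _ => le_rfl)).antisymm
    (h.le_of_isLevelLimit hΓ hlim' hlim (.of_forall fun _ => le_rfl))

theorem le_normalizer_of_isLevelLimit (hΓ : IsClosed (Γ : Set G)) (hlim : IsLevelLimit t g U Γ Λ)
    {N : Subgroup G} (hN : IsLevelLimit t g U N (fun a => 𝐍(Λ a))) : N ≤ 𝐍(Γ) := by
  refine Subgroup.le_normalizer_iff.2 fun x hx q hq => h.mem_of_forall hΓ fun i => ?_
  obtain ⟨a, ⟨hi, hNa⟩, _, hΓa⟩ := ((hN i).and (hlim i)).exists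
  obtain ⟨y, hy, hyx⟩ := hNa.le (Subgroup.mem_map_of_mem (g i) hx)
  obtain ⟨r, hr, hrq⟩ := hΓa.le (Subgroup.mem_map_of_mem (g i) hq)
  rw [hΓa, map_mul, map_mul, map_inv, ← hyx, ← hrq, ← map_inv, ← map_mul, ← map_mul]
  exact Subgroup.mem_map_of_mem _ ((hy r).1 hr)

theorem eventually_map_normalizer_le [∀ i, Finite (H i)] (hU : Filter.Tendsto ℓ U Filter.atTop)
    (hΓ : IsClosed (Γ : Set G)) (hlim : IsLevelLimit t g U Γ Λ) (i : I) :
    ∀ᶠ a in U, ∃ hi : i ≤ ℓ a, 𝐍(Λ a).map (t i (ℓ a) hi) ≤ 𝐍(Γ).map (g i) := by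
  obtain ⟨N, -, hN⟩ := h.exists_isLevelLimit hU fun a => 𝐍(Λ a)
  refine (hN i).mono ?_
  rintro a ⟨hi, ha⟩
  exact ⟨hi, ha ▸ Subgroup.map_mono (h.le_normalizer_of_isLevelLimit hΓ hlim hN)⟩

end IsLevelLimit

end IsGroupLimit

namespace IsRelLevelLimit

variable {I : Type*} [Preorder I] {G : Type*} [Group G] {H : I → Type*} [∀ i, Group (H i)]
  {t : ∀ i j : I, i ≤ j → H j →* H i} {g : ∀ i, G →* H i} {A : Type*} {ℓ : A → I}
  {U : Ultrafilter A} {Γ : GroupRel G G} {Λ : ∀ a, GroupRel (H (ℓ a)) (H (ℓ a))}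

theorem dom (hlim : IsRelLevelLimit t g U Γ Λ) :
    IsLevelLimit t g U Γ.dom (fun a => (Λ a).dom) :=
  fun i => (hlim i).mono fun a ⟨hi, ha⟩ => ⟨hi, by
    rw [← GroupRel.dom_image, ← GroupRel.dom_image]
    exact congrArg GroupRel.dom ha⟩

theorem ran (hlim : IsRelLevelLimit t g U Γ Λ) :
    IsLevelLimit t g U Γ.ran (fun a => (Λ a).ran) :=
  fun i => (hlim i).mono fun a ⟨hi, ha⟩ => ⟨hi, by
    rw [← GroupRel.ran_image, ← GroupRel.ran_image]
    exact congrArg GroupRel.ran ha⟩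

end IsRelLevelLimit

namespace SubgroupCategory

open GroupRel

section Graphs

variable {S : Type u} [Group S] [TopologicalSpace S]

/-- `Γ` is the graph of a morphism of `F`. -/
def IsGraph (F : SubgroupCategory S) (Γ : GroupRel S S) : Prop :=
  ∃ P Q : ClosedSubgroup S, ∃ φ ∈ F.Hom P Q, graph φ = Γ

variable {F : SubgroupCategory S} {Γ Δ : GroupRel S S} {P Q : ClosedSubgroup S} {φ : P →ₜ* Q}

theorem isGraph_of_mem (h : φ ∈ F.Hom P Q) : F.IsGraph (graph φ) :=
  ⟨P, Q, φ, h, rfl⟩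

theorem mem_hom_of_graph_eq {P' Q' : ClosedSubgroup S} {φ' : P' →ₜ* Q'} (hφ : φ ∈ F.Hom P Q)
    (h : graph φ = graph φ') (hQ : Q = Q') : φ' ∈ F.Hom P' Q' := by
  have hP : P = P' := ClosedSubgroup.toSubgroup_injective <| by
    rw [← dom_graph φ, h, dom_graph]
  subst hP hQ
  exact graph_injective h ▸ hφ

theorem IsGraph.isFunctional (h : F.IsGraph Γ) : Γ.IsFunctional := by
  obtain ⟨P, Q, φ, -, rfl⟩ := h
  exact isFunctional_graph φ

theorem IsGraph.isClosed [CompactSpace S] [T2Space S] (h : F.IsGraph Γ) :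
    IsClosed (Γ : Set (S × S)) := by
  obtain ⟨P, Q, φ, -, rfl⟩ := h
  exact isClosed_graph φ

theorem IsIso.ran_graph (hφ : F.IsIso φ) : (graph φ).ran = Q.toSubgroup := by
  obtain ⟨-, ψ, -, -, hφψ⟩ := hφ
  refine (ran_graph_le φ).antisymm fun y hy => mem_ran.2 ⟨ψ ⟨y, hy⟩, ?_⟩
  exact mem_graph.2 ⟨ψ ⟨y, hy⟩, rfl, by rw [hφψ]⟩

theorem isIso_of_graph_eq_inv {ψ : Q →ₜ* P} (hφ : φ ∈ F.Hom P Q) (hψ : ψ ∈ F.Hom Q P)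
    (h : graph ψ = (graph φ).inv) : F.IsIso φ := by
  refine ⟨hφ, ψ, hψ, fun a => Subtype.ext (apply_eq_of_mem_graph ?_),
    fun b => Subtype.ext (apply_eq_of_mem_graph ?_)⟩
  · rw [h]
    exact apply_mem_graph φ a
  · rw [← mem_inv, ← h]
    exact apply_mem_graph ψ b

namespace IsFusionSystem

variable (hF : F.IsFusionSystem)
include hF

theorem exists_comp_inclusion (hφ : φ ∈ F.Hom P Q) {R : ClosedSubgroup S} (hQR : Q ≤ R) :
    ∃ ψ ∈ F.Hom P R, graph ψ = graph φ := by
  let ι : Q →ₜ* R :=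
    { toMonoidHom := Subgroup.inclusion hQR
      continuous_toFun := continuous_inclusion hQR }
  exact ⟨_, F.comp_mem hφ (hF.conj_mem ι 1 fun a => by rw [one_mul, inv_one, mul_one]; rfl), rfl⟩

theorem exists_inclusion_comp (hφ : φ ∈ F.Hom P Q) {R : ClosedSubgroup S} (hRP : R ≤ P) :
    ∃ ψ ∈ F.Hom R Q, graph ψ = (graph φ).restrict R.toSubgroup := by
  let ι : R →ₜ* P :=
    { toMonoidHom := Subgroup.inclusion hRP
      continuous_toFun := continuous_inclusion hRP }
  refine ⟨_, F.comp_mem (hF.conj_mem ι 1 fun a => by rw [one_mul, inv_one, mul_one]; rfl) hφ, ?_⟩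
  ext ⟨x, y⟩
  rw [mem_restrict, mem_graph_iff, mem_graph_iff]
  exact ⟨fun ⟨hx, hy⟩ => ⟨⟨hRP hx, hy⟩, hx⟩, fun ⟨⟨_, hy⟩, hx⟩ => ⟨hx, hy⟩⟩

theorem mem_hom_of_isGraph (h : F.IsGraph (graph φ)) : φ ∈ F.Hom P Q := by
  obtain ⟨P', Q', φ', hφ', hφφ'⟩ := h
  obtain ⟨R, -, ψ, hψ, hψφ'⟩ := hF.factor hφ'
  have hgraph : graph ψ = graph φ := hφφ' ▸ by
    ext ⟨x, y⟩
    simp only [mem_graph, hψφ']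
  have hRQ : R.toSubgroup ≤ Q.toSubgroup := by
    rw [← hψ.ran_graph, hgraph]
    exact ran_graph_le φ
  obtain ⟨χ, hχ, hχψ⟩ := hF.exists_comp_inclusion hψ.1 (R := Q) hRQ
  exact mem_hom_of_graph_eq hχ (hχψ.trans hgraph) rfl

theorem isGraph_inv (h : F.IsGraph Γ) : F.IsGraph Γ.inv := by
  obtain ⟨P, Q, φ, hφ, rfl⟩ := h
  obtain ⟨R, -, ψ, ⟨-, ψ', hψ', hψ'ψ, hψψ'⟩, hψφ⟩ := hF.factor hφ
  refine ⟨R, P, ψ', hψ', ?_⟩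
  rw [graph_inv hψ'ψ hψψ']
  congr 1
  ext ⟨x, y⟩
  simp only [mem_graph, hψφ]

theorem isFunctional_inv (h : F.IsGraph Γ) : Γ.inv.IsFunctional :=
  (hF.isGraph_inv h).isFunctional

theorem isGraph_conj [IsTopologicalGroup S] (P : ClosedSubgroup S) (s : S) :
    F.IsGraph (conj P.toSubgroup s) := by
  let T : ClosedSubgroup S := ⟨⊤, isClosed_univ⟩
  let φ : P →ₜ* T :=
    { toFun := fun a => ⟨s * a * s⁻¹, trivial⟩
      map_one' := Subtype.ext (by simp)
      map_mul' := fun a b => Subtype.ext (by simp)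
      continuous_toFun := by fun_prop }
  refine ⟨P, T, φ, hF.conj_mem φ s fun a => rfl, ?_⟩
  ext ⟨x, y⟩
  rw [mem_conj, mem_graph_iff]
  exact ⟨fun ⟨hx, hy⟩ => ⟨hx, hy.symm⟩, fun ⟨hx, hy⟩ => ⟨hx, hy.symm⟩⟩

theorem card_dom_eq_card_ran (h : F.IsGraph Γ) : Nat.card Γ.dom = Nat.card Γ.ran := by
  rw [dom, ran, ← Nat.card_eq_of_bijective _ ⟨?_, (MonoidHom.fst S S).subgroupMap_surjective Γ⟩,
    ← Nat.card_eq_of_bijective _ ⟨?_, (MonoidHom.snd S S).subgroupMap_surjective Γ⟩]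
  · rintro ⟨⟨x, y⟩, hxy⟩ ⟨⟨x', y'⟩, hxy'⟩ hyy'
    obtain rfl : y = y' := congrArg Subtype.val hyy'
    exact Subtype.ext (Prod.ext ((hF.isFunctional_inv h).eq hxy hxy') rfl)
  · rintro ⟨⟨x, y⟩, hxy⟩ ⟨⟨x', y'⟩, hxy'⟩ hxx'
    obtain rfl : x = x' := congrArg Subtype.val hxx'
    exact Subtype.ext (Prod.ext rfl (h.isFunctional.eq hxy hxy'))

variable [CompactSpace S]

theorem isGraph_of_le (h : F.IsGraph Γ) (hΔ : IsClosed (Δ : Set (S × S))) (hle : Δ ≤ Γ) :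
    F.IsGraph Δ := by
  have hrestrict := h.isFunctional.restrict_dom_of_le hle
  obtain ⟨P, Q, φ, hφ, rfl⟩ := h
  let R : ClosedSubgroup S := ⟨Δ.dom, isClosed_dom hΔ⟩
  have hRP : R.toSubgroup ≤ P.toSubgroup := dom_graph φ ▸ dom_mono hle
  obtain ⟨ψ, hψ, hψΔ⟩ := hF.exists_inclusion_comp hφ (R := R) hRP
  exact ⟨R, Q, ψ, hψ, hψΔ.trans hrestrict⟩

variable [T2Space S]

theorem isGraph_restrict (h : F.IsGraph Γ) (P : ClosedSubgroup S) :
    F.IsGraph (Γ.restrict P.toSubgroup) :=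
  hF.isGraph_of_le h (isClosed_restrict h.isClosed P.isClosed') (restrict_le Γ _)

theorem exists_mem_hom (h : F.IsGraph Γ) (hP : Γ.dom = P.toSubgroup)
    (hQ : Γ.ran ≤ Q.toSubgroup) : ∃ φ ∈ F.Hom P Q, graph φ = Γ := by
  obtain ⟨φ, rfl⟩ := exists_graph_eq h.isClosed h.isFunctional hP hQ
  exact ⟨φ, hF.mem_hom_of_isGraph h, rfl⟩

theorem isGraph_comp (hΓ : F.IsGraph Γ) (hΔ : F.IsGraph Δ) : F.IsGraph (Γ.comp Δ) := by
  obtain ⟨P, Q, ψ, hψ, rfl⟩ := hΔ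
  have hΓ' := hF.isGraph_inv (hF.isGraph_restrict (hF.isGraph_inv hΓ) P)
  obtain ⟨φ, hφ, hφΓ⟩ := hF.exists_mem_hom hΓ' (P := ⟨_, isClosed_dom hΓ'.isClosed⟩) (Q := P) rfl
    (by rw [ran_inv]; rintro y hy; obtain ⟨x, -, hyP⟩ := mem_dom.1 hy; exact hyP)
  refine ⟨_, _, _, F.comp_mem hφ hψ, ?_⟩
  rw [graph_comp, hφΓ]
  ext ⟨x, z⟩
  refine exists_congr fun y => ⟨fun ⟨hxy, hyz⟩ => ⟨hxy.1, hyz⟩, fun ⟨hxy, hyz⟩ =>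
    ⟨⟨hxy, dom_graph ψ ▸ mem_dom.2 ⟨z, hyz⟩⟩, hyz⟩⟩

theorem isIso_iff : F.IsIso φ ↔ φ ∈ F.Hom P Q ∧ (graph φ).ran = Q.toSubgroup := by
  refine ⟨fun hφ => ⟨hφ.1, hφ.ran_graph⟩, fun ⟨hφ, hran⟩ => ?_⟩
  obtain ⟨ψ, hψ, hψφ⟩ := hF.exists_mem_hom (hF.isGraph_inv (isGraph_of_mem hφ)) (P := Q) (Q := P)
    (dom_inv.trans hran) (ran_inv.trans (dom_graph φ)).le
  exact isIso_of_graph_eq_inv hφ hψ hψφ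

theorem exists_isIso (h : F.IsGraph Γ) (hP : Γ.dom = P.toSubgroup) (hQ : Γ.ran = Q.toSubgroup) :
    ∃ φ : P →ₜ* Q, F.IsIso φ ∧ graph φ = Γ := by
  obtain ⟨φ, hφ, rfl⟩ := hF.exists_mem_hom h hP hQ.le
  exact ⟨φ, hF.isIso_iff.2 ⟨hφ, hQ⟩, rfl⟩

end IsFusionSystem

end Graphs

section Morphisms

variable {S : Type u} [Group S] [TopologicalSpace S] [CompactSpace S]
  {T : Type v} [Group T] [TopologicalSpace T] [T2Space T]

theorem IsMorphism.isGraph_image {F : SubgroupCategory S} {G : SubgroupCategory T} {α : S →ₜ* T}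
    (h : IsMorphism F G α) {Γ : GroupRel S S} (hΓ : F.IsGraph Γ) :
    G.IsGraph (Γ.image (α : S →* T)) := by
  obtain ⟨P, Q, φ, hφ, rfl⟩ := hΓ
  obtain ⟨ψ, hψ, hψφ⟩ := h P Q φ hφ
  exact ⟨_, _, ψ, hψ, graph_eq_image α hψφ⟩

end Morphisms

section Isomorphisms

variable {S : Type u} [Group S] [TopologicalSpace S] [CompactSpace S] [T2Space S]
  {T : Type v} [Group T] [TopologicalSpace T] [CompactSpace T] [T2Space T] {e : S ≃ₜ* T}
  {P Q : ClosedSubgroup S} {φ : P →ₜ* Q}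

theorem exists_graph_eq_image (e : S ≃ₜ* T) (φ : P →ₜ* Q) :
    ∃ ψ : P.image (e : S →ₜ* T) →ₜ* Q.image (e : S →ₜ* T),
      graph ψ = (graph φ).image (e : S →ₜ* T) := by
  refine exists_graph_eq ?_ ?_ ?_ ?_
  · exact (e.toHomeomorph.prodCongr e.toHomeomorph).isClosedMap _ (isClosed_graph φ)
  · intro y hy
    obtain ⟨a, b, hab, ha, rfl⟩ := mem_image.1 hy
    obtain rfl := (map_eq_one_iff e e.injective).1 ha
    rw [isFunctional_graph φ b hab, map_one]
  · rw [dom_image, dom_graph]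
    rfl
  · rw [ran_image]
    exact Subgroup.map_mono (ran_graph_le φ)

theorem mem_hom_iff_of_graph_eq_image {F : SubgroupCategory S} {G : SubgroupCategory T}
    (h : IsMorphism F G (e : S →ₜ* T)) (h' : IsMorphism G F (e.symm : T →ₜ* S))
    {ψ : P.image (e : S →ₜ* T) →ₜ* Q.image (e : S →ₜ* T)}
    (hψ : graph ψ = (graph φ).image (e : S →ₜ* T)) :
    φ ∈ F.Hom P Q ↔ ψ ∈ G.Hom (P.image (e : S →ₜ* T)) (Q.image (e : S →ₜ* T)) := by
  constructor
  · intro hφ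
    obtain ⟨ψ', hψ', hψ'φ⟩ := h P Q φ hφ
    exact mem_hom_of_graph_eq hψ' ((graph_eq_image _ hψ'φ).trans hψ.symm) rfl
  · intro hψG
    obtain ⟨χ, hχ, hχψ⟩ := h' _ _ ψ hψG
    have hsymm_comp : ((e.symm : T →ₜ* S) : T →* S).comp ((e : S →ₜ* T) : S →* T) = .id S :=
      MonoidHom.ext e.symm_apply_apply
    refine mem_hom_of_graph_eq hχ ?_ (ClosedSubgroup.toSubgroup_injective ?_)
    · rw [graph_eq_image _ hχψ, hψ, image_image, hsymm_comp, image_id]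
    · exact (Subgroup.map_map _ _ _).trans
        ((congrArg Q.toSubgroup.map hsymm_comp).trans (Subgroup.map_id _))

end Isomorphisms

end SubgroupCategory

namespace FusionInverseSystem

open GroupRel

variable {p : ℕ} {I : Type w} [PartialOrder I] (D : FusionInverseSystem.{v, w} p I)

/-- The transition maps of an inverse system, as homomorphisms of abstract groups. -/
def transition (i j : I) (hij : i ≤ j) : D.grp j →* D.grp i :=
  (D.map hij).toMonoidHom

variable {D}

theorem isGraph_transition {i j : I} (hij : i ≤ j) {Γ : GroupRel (D.grp j) (D.grp j)}
    (hΓ : (D.fus j).IsGraph Γ) : (D.fus i).IsGraph (Γ.image (D.transition i j hij)) :=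
  (D.isMorphism hij).isGraph_image hΓ

theorem mem_lim_hom_iff {P Q : ClosedSubgroup D.Lim} {φ : P →ₜ* Q} :
    φ ∈ D.lim.Hom P Q ↔ ∀ i, (D.fus i).IsGraph ((graph φ).image (D.proj i)) := by
  refine forall_congr' fun i => ⟨fun ⟨f, hf, hfφ⟩ => ⟨_, _, f, hf, graph_eq_image _ hfφ⟩,
    fun hφ => ?_⟩
  obtain ⟨f, hf, hfφ⟩ := (D.isFusionSystem i).exists_mem_hom hφ (P := P.image (D.proj i))
    (Q := Q.image (D.proj i)) (by rw [dom_image, dom_graph]; rfl)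
    (by rw [ran_image]; exact Subgroup.map_mono (ran_graph_le φ))
  exact ⟨f, hf, fun a => apply_eq_of_mem_graph <|
    hfφ ▸ Subgroup.mem_map_of_mem _ (apply_mem_graph φ a)⟩

end FusionInverseSystem

namespace SubgroupCategory

open GroupRel

/-- The category `F` on `S` is, by means of the maps `g i`, the inverse limit of the system
`D`. -/
structure IsFusionLimit {p : ℕ} {I : Type w} [PartialOrder I] {S : Type u} [Group S]
    [TopologicalSpace S] (F : SubgroupCategory S) (D : FusionInverseSystem.{v, w} p I)
    (g : ∀ i, S →* D.grp i) : Prop where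
  isGroupLimit : IsGroupLimit D.transition g
  mem_hom_iff : ∀ {P Q : ClosedSubgroup S} {φ : P →ₜ* Q},
    φ ∈ F.Hom P Q ↔ ∀ i, (D.fus i).IsGraph ((graph φ).image (g i))

section IsFusionLimit

variable {p : ℕ} {I : Type w} [PartialOrder I] {S : Type u} [Group S] [TopologicalSpace S]
  [CompactSpace S] [T2Space S] {F : SubgroupCategory S} {D : FusionInverseSystem.{v, w} p I}
  {g : ∀ i, S →* D.grp i}

theorem IsIsomorphic.exists_isFusionLimit (h : IsIsomorphic F D.lim) :
    ∃ g : ∀ i, S →* D.grp i, IsFusionLimit F D g := by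
  obtain ⟨e, he, he'⟩ := h
  refine ⟨fun i => ((D.proj i : D.Lim →* D.grp i)).comp (e : S →ₜ* D.Lim), ?_, ?_⟩
  · exact
      { discreteTopology := fun i => inferInstance
        continuous := fun i => (D.proj i).continuous_toFun.comp e.continuous
        map_apply := fun {i j} hij a => (e a).2 i j hij
        map_map := D.map_comp
        eq_one := fun a ha =>
          (map_eq_one_iff e e.injective).1 (Subtype.ext (funext ha))
        exists_of_compatible := fun a ha => ⟨e.symm ⟨a, ha⟩, fun i =>
          congrArg (D.proj i) (e.apply_symm_apply ⟨a, ha⟩)⟩ }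
  · intro P Q φ
    obtain ⟨ψ, hψ⟩ := exists_graph_eq_image e φ
    rw [mem_hom_iff_of_graph_eq_image he he' hψ, FusionInverseSystem.mem_lim_hom_iff, hψ]
    simp only [image_image]

namespace IsFusionLimit

omit [CompactSpace S] [T2Space S] in
theorem isGraph_image (h : IsFusionLimit F D g) {Γ : GroupRel S S} (hΓ : F.IsGraph Γ) (i : I) :
    (D.fus i).IsGraph (Γ.image (g i)) := by
  obtain ⟨P, Q, φ, hφ, rfl⟩ := hΓ
  exact h.mem_hom_iff.1 hφ i

variable (h : IsFusionLimit F D g) {Γ : GroupRel S S}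
include h

omit [T2Space S] in
theorem exists_mem_hom_of_image (hΓ : IsClosed (Γ : Set (S × S)))
    (hΓi : ∀ i, (D.fus i).IsGraph (Γ.image (g i))) {P Q : ClosedSubgroup S}
    (hP : Γ.dom = P.toSubgroup) (hQ : Γ.ran ≤ Q.toSubgroup) :
    ∃ φ ∈ F.Hom P Q, graph φ = Γ := by
  obtain ⟨φ, rfl⟩ := exists_graph_eq hΓ (fun y hy => h.isGroupLimit.eq_one y fun i =>
    (hΓi i).isFunctional _ (mem_image.2 ⟨1, y, hy, map_one _, rfl⟩)) hP hQ
  exact ⟨φ, h.mem_hom_iff.2 hΓi, rfl⟩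

omit [T2Space S] in
theorem isGraph_of_image (hΓ : IsClosed (Γ : Set (S × S)))
    (hΓi : ∀ i, (D.fus i).IsGraph (Γ.image (g i))) : F.IsGraph Γ := by
  obtain ⟨φ, hφ, hφΓ⟩ := h.exists_mem_hom_of_image hΓ hΓi (P := ⟨Γ.dom, isClosed_dom hΓ⟩)
    (Q := ⟨⊤, isClosed_univ⟩) rfl le_top
  exact ⟨_, _, φ, hφ, hφΓ⟩

theorem exists_mem_hom_inv {P Q R : ClosedSubgroup S} {φ : P →ₜ* Q} (hφ : φ ∈ F.Hom P Q)
    (hR : (graph φ).ran = R.toSubgroup) : ∃ ψ ∈ F.Hom R P, graph ψ = (graph φ).inv := by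
  refine h.exists_mem_hom_of_image (isClosed_inv (isClosed_graph φ)) (fun i => ?_)
    (dom_inv.trans hR) (ran_inv.trans (dom_graph φ)).le
  rw [← inv_image]
  exact (D.isFusionSystem i).isGraph_inv (h.mem_hom_iff.1 hφ i)

theorem isFusionSystem : F.IsFusionSystem where
  injective {P Q φ} hφ a b hab := by
    obtain ⟨ψ, -, hψφ⟩ := h.exists_mem_hom_inv hφ (R := ⟨_, isClosed_ran (isClosed_graph φ)⟩) rfl
    refine Subtype.ext ((hψφ ▸ isFunctional_graph ψ).eq (apply_mem_graph φ a) ?_)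
    exact hab ▸ apply_mem_graph φ b
  conj_mem {P Q} φ s hφ := h.mem_hom_iff.2 fun i => by
    have hi := D.isFusionSystem i
    refine hi.isGraph_of_le (hi.isGraph_conj ⟨⊤, isClosed_univ⟩ (g i s)) (isClosed_discrete _) ?_
    rintro ⟨x, y⟩ hxy
    obtain ⟨a, _, hab, rfl, rfl⟩ := mem_image.1 hxy
    obtain ⟨ha, rfl⟩ := mem_graph_iff.1 hab
    exact mem_conj.2 ⟨trivial, by rw [hφ, map_mul, map_mul, map_inv]⟩
  factor {P Q φ} hφ := by
    let R : ClosedSubgroup S := ⟨_, isClosed_ran (isClosed_graph φ)⟩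
    obtain ⟨φ', hφ', hφ'φ⟩ := h.exists_mem_hom_of_image (isClosed_graph φ) (h.mem_hom_iff.1 hφ)
      (P := P) (Q := R) (dom_graph φ) le_rfl
    obtain ⟨ψ, hψ, hψφ⟩ := h.exists_mem_hom_inv hφ (R := R) rfl
    exact ⟨R, ran_graph_le φ, φ', isIso_of_graph_eq_inv hφ' hψ (by rw [hψφ, hφ'φ]),
      fun a => apply_eq_of_graph_eq hφ'φ.ge rfl⟩

omit [T2Space S] in
theorem exists_isGraph_isLevelLimit {A : Type x} {ℓ : A → I} {U : Ultrafilter A}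
    (hU : Filter.Tendsto ℓ U Filter.atTop) {Λ : ∀ a, GroupRel (D.grp (ℓ a)) (D.grp (ℓ a))}
    (hΛ : ∀ a, (D.fus (ℓ a)).IsGraph (Λ a)) :
    ∃ Γ, F.IsGraph Γ ∧ IsRelLevelLimit D.transition g U Γ Λ := by
  obtain ⟨Γ, hΓ, hlim⟩ := h.isGroupLimit.prod.exists_isLevelLimit hU Λ
  refine ⟨Γ, h.isGraph_of_image hΓ fun i => ?_, hlim⟩
  obtain ⟨a, hi, ha⟩ := (hlim i).exists
  change (D.fus i).IsGraph (Subgroup.map _ Γ)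
  rw [ha]
  exact FusionInverseSystem.isGraph_transition hi (hΛ a)

end IsFusionLimit

end IsFusionLimit

/-- `P` and `Q` are isomorphic in the category `F`. -/
def IsConj {S : Type u} [Group S] [TopologicalSpace S] (F : SubgroupCategory S)
    (P Q : Subgroup S) : Prop :=
  ∃ Γ, F.IsGraph Γ ∧ Γ.dom = P ∧ Γ.ran = Q

/-- Each morphism of `F` that is defined on the normalizer of `Q` maps it onto the normalizer of
the image of `Q`. -/
def IsNormalizerMaximal {S : Type u} [Group S] [TopologicalSpace S] (F : SubgroupCategory S)
    (Q : Subgroup S) : Prop :=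
  ∀ ⦃χ⦄, F.IsGraph χ → 𝐍(Q) ≤ χ.dom → 𝐍((χ.restrict Q).ran) ≤ (χ.restrict 𝐍(Q)).ran

section Conjugacy

variable {S : Type u} [Group S] [TopologicalSpace S] {F : SubgroupCategory S}

theorem IsFusionSystem.isConj_refl [IsTopologicalGroup S] (hF : F.IsFusionSystem)
    (P : ClosedSubgroup S) : F.IsConj P.toSubgroup P.toSubgroup :=
  ⟨_, hF.isGraph_conj P 1, dom_conj _ _, by ext; simp [mem_ran, mem_conj]⟩

theorem IsFusionSystem.isConj_trans [CompactSpace S] [T2Space S] (hF : F.IsFusionSystem)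
    {P Q R : Subgroup S} (hPQ : F.IsConj P Q) (hQR : F.IsConj Q R) : F.IsConj P R := by
  obtain ⟨Γ, hΓ, rfl, rfl⟩ := hPQ
  obtain ⟨Δ, hΔ, hdom, rfl⟩ := hQR
  exact ⟨_, hF.isGraph_comp hΓ hΔ, dom_comp hdom.ge, ran_comp hdom.le⟩

omit [TopologicalSpace S] in
theorem ran_restrict_normalizer_le (Γ : GroupRel S S) (Q : Subgroup S) :
    (Γ.restrict 𝐍(Q)).ran ≤ 𝐍((Γ.restrict Q).ran) := by
  intro y hy
  obtain ⟨x, hxy, hx⟩ := mem_ran.1 hy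
  exact mem_normalizer_ran (mem_normalizer_restrict hxy hx)

end Conjugacy

end SubgroupCategory

namespace SubgroupCategory.IsFusionLimit

open GroupRel

variable {p : ℕ} {I : Type w} [PartialOrder I] {S : Type u} [Group S] [TopologicalSpace S]
  {F : SubgroupCategory S} {D : FusionInverseSystem.{v, w} p I}

/-- The orders of the images of the normalizer of `Q` at the levels of an inverse system. -/
noncomputable def normalizerCard (g : ∀ i, S →* D.grp i) (Q : Subgroup S) (i : I) : ℕ :=
  Nat.card (𝐍(Q).map (g i))

variable [CompactSpace S] [T2Space S] {g : ∀ i, S →* D.grp i} (h : IsFusionLimit F D g)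
include h

variable [Nonempty I] [IsDirectedOrder I]

theorem exists_isConj_normalizerCard_ge {A : Type x} [Preorder A] [Nonempty A] [IsDirectedOrder A]
    {P : Subgroup S} (hP : IsClosed (P : Set S)) {q : A → Subgroup S}
    (hq : ∀ a, F.IsConj P (q a)) (hmono : Monotone fun a => normalizerCard g (q a)) :
    ∃ Q, F.IsConj P Q ∧ ∀ a, normalizerCard g (q a) ≤ normalizerCard g Q := by
  choose Γ hΓ hΓP hΓq using hq
  let U : Ultrafilter (A × I) := .of (Filter.atTop ×ˢ Filter.atTop)
  have hU : Filter.Tendsto Prod.fst (U : Filter (A × I)) Filter.atTop :=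
    Filter.tendsto_fst.mono_left (Ultrafilter.of_le _)
  have hU' : Filter.Tendsto Prod.snd (U : Filter (A × I)) Filter.atTop :=
    Filter.tendsto_snd.mono_left (Ultrafilter.of_le _)
  obtain ⟨Δ, hΔ, hlim⟩ := h.exists_isGraph_isLevelLimit hU'
    (Λ := fun a => (Γ a.1).image (g a.2)) fun a => h.isGraph_image (hΓ a.1) a.2
  have hdom : IsLevelLimit D.transition g U Δ.dom fun a : A × I => P.map (g a.2) := by
    simpa only [dom_image, hΓP] using hlim.dom
  have hran : IsLevelLimit D.transition g U Δ.ran fun a : A × I => (q a.1).map (g a.2) := by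
    simpa only [ran_image, hΓq] using hlim.ran
  refine ⟨Δ.ran, ⟨Δ, hΔ, ?_, rfl⟩, fun a i => ?_⟩
  · exact h.isGroupLimit.eq_of_isLevelLimit (isClosed_dom hΔ.isClosed) hP hdom
      (h.isGroupLimit.isLevelLimit_map hU' P)
  · obtain ⟨⟨b, j⟩, ⟨hij, hle⟩, hab⟩ := ((h.isGroupLimit.eventually_map_normalizer_le hU'
      (isClosed_ran hΔ.isClosed) hran i).and (hU.eventually_ge_atTop a)).exists
    refine (hmono hab i).trans (Subgroup.card_le_of_le ?_)
    rw [← h.isGroupLimit.map_map_eq hij]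
    exact (Subgroup.map_mono (Subgroup.le_normalizer_map _)).trans hle

theorem exists_isConj_normalizerCard_maximal [IsTopologicalGroup S] (P : ClosedSubgroup S) :
    ∃ Q, F.IsConj P.toSubgroup Q ∧ ∀ R, F.IsConj P.toSubgroup R →
      normalizerCard g Q ≤ normalizerCard g R → normalizerCard g R ≤ normalizerCard g Q := by
  let C : Set (I → ℕ) := {n | ∃ Q, F.IsConj P.toSubgroup Q ∧ normalizerCard g Q = n}
  have hbdd : ∀ c ⊆ C, IsChain (· ≤ ·) c → ∀ n ∈ c, ∃ b ∈ C, ∀ n ∈ c, n ≤ b := by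
    intro c hc hchain n hn
    have : Nonempty c := ⟨⟨n, hn⟩⟩
    have : IsDirectedOrder c := hchain.directedOn.isDirectedOrder
    choose q hq hqc using fun a : c => hc a.2
    obtain ⟨Q, hQ, hle⟩ := h.exists_isConj_normalizerCard_ge P.isClosed' hq
      (fun a b hab => by simpa only [hqc] using Subtype.coe_le_coe.2 hab)
    exact ⟨_, ⟨Q, hQ, rfl⟩, fun n hn => (hqc ⟨n, hn⟩).ge.trans (hle ⟨n, hn⟩)⟩
  obtain ⟨m, -, hm⟩ := zorn_le_nonempty₀ C hbdd _ ⟨_, h.isFusionSystem.isConj_refl P, rfl⟩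
  obtain ⟨Q, hQ, rfl⟩ := hm.prop
  exact ⟨Q, hQ, fun R hR hle => hm.le_of_ge ⟨R, hR, rfl⟩ hle⟩

theorem exists_isConj_isNormalizerMaximal [IsTopologicalGroup S] (P : ClosedSubgroup S) :
    ∃ Q, F.IsConj P.toSubgroup Q ∧ F.IsNormalizerMaximal Q := by
  have hF := h.isFusionSystem
  obtain ⟨Q, hPQ, hmax⟩ := h.exists_isConj_normalizerCard_maximal P
  refine ⟨Q, hPQ, fun χ hχ hN => ?_⟩
  have hQ : IsClosed (Q : Set S) := by
    obtain ⟨Γ, hΓ, -, rfl⟩ := hPQ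
    exact isClosed_ran hΓ.isClosed
  let χN := χ.restrict 𝐍(Q)
  let R := (χ.restrict Q).ran
  have hχN : F.IsGraph χN := hF.isGraph_restrict hχ (ClosedSubgroup.normalizer ⟨Q, hQ⟩)
  have hχQ : F.IsGraph (χ.restrict Q) := hF.isGraph_restrict hχ ⟨Q, hQ⟩
  have hR : F.IsConj P.toSubgroup R :=
    hF.isConj_trans hPQ ⟨_, hχQ, dom_restrict (Subgroup.le_normalizer.trans hN), rfl⟩
  have hcard : ∀ i, normalizerCard g Q i = Nat.card (χN.ran.map (g i)) := fun i => by
    rw [← ran_image, ← (D.isFusionSystem i).card_dom_eq_card_ran (h.isGraph_image hχN i),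
      dom_image, dom_restrict hN]
    rfl
  have hle : χN.ran ≤ 𝐍(R) := ran_restrict_normalizer_le χ Q
  have hge := hmax R hR fun i => hcard i ▸ Subgroup.card_le_of_le (Subgroup.map_mono hle)
  exact h.isGroupLimit.le_of_forall (isClosed_ran hχN.isClosed) fun i =>
    (Subgroup.eq_of_le_of_card_ge (Subgroup.map_mono hle) (hcard i ▸ hge i)).ge

end SubgroupCategory.IsFusionLimit

namespace SubgroupCategory

open GroupRel

section Receptive

variable {S : Type u} [Group S] [TopologicalSpace S] [IsTopologicalGroup S] [CompactSpace S]
  [T2Space S] {F : SubgroupCategory S}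

theorem mem_extender_iff {R Q : ClosedSubgroup S} {φ : R →ₜ* Q}
    (hφ : (graph φ).ran = Q.toSubgroup) {x : S} :
    x ∈ extender φ ↔ x ∈ GroupRel.dom 𝐍(graph φ) := by
  rw [mem_dom]
  constructor
  · rintro ⟨hx, y, _, hxy⟩
    refine ⟨y, mem_normalizer_of_forall (isFunctional_graph φ) ?_ fun a b hab => ?_⟩
    · rwa [dom_graph]
    · obtain ⟨r, rfl, rfl⟩ := mem_graph.1 hab
      exact mem_graph.2 ⟨⟨x * r * x⁻¹, (hx _).1 r.2⟩, rfl, hxy r _ rfl⟩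
  · rintro ⟨y, hxy⟩
    have hx := mem_normalizer_dom hxy
    have hy := mem_normalizer_ran hxy
    rw [dom_graph] at hx
    rw [hφ] at hy
    refine ⟨hx, y, hy, fun r r' hr => apply_eq_of_mem_graph ?_⟩
    rw [hr]
    exact (hxy _).1 (apply_mem_graph φ r)

theorem IsFusionSystem.isReceptive_iff (hF : F.IsFusionSystem) {Q : ClosedSubgroup S} :
    F.IsReceptive Q ↔ ∀ Γ, F.IsGraph Γ → Γ.ran = Q.toSubgroup →
      ∃ Δ, F.IsGraph Δ ∧ Γ ≤ Δ ∧ GroupRel.dom 𝐍(Γ) ≤ Δ.dom := by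
  constructor
  · intro hQ Γ hΓ hΓQ
    obtain ⟨P, hP⟩ : ∃ P : ClosedSubgroup S, Γ.dom = P.toSubgroup :=
      ⟨⟨_, isClosed_dom hΓ.isClosed⟩, rfl⟩
    obtain ⟨φ, hφ, rfl⟩ := hF.exists_isIso hΓ hP hΓQ
    obtain ⟨ψ, hψ, hψφ⟩ := hQ _ φ hφ
    refine ⟨_, isGraph_of_mem hψ, ?_, fun x hx => ?_⟩
    · rintro ⟨x, y⟩ hxy
      obtain ⟨a, rfl, rfl⟩ := mem_graph.1 hxy
      exact mem_graph.2 ⟨⟨a, le_extender φ a⟩, rfl, hψφ a⟩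
    · rw [dom_graph]
      exact (mem_extender_iff hΓQ).2 hx
  · intro h R φ hφ
    obtain ⟨Δ, hΔ, hφΔ, hN⟩ := h _ (isGraph_of_mem hφ.1) hφ.ran_graph
    have hdom : (extender φ).toSubgroup ≤ Δ.dom := fun x hx =>
      hN ((mem_extender_iff hφ.ran_graph).1 hx)
    have hran : (Δ.restrict (extender φ).toSubgroup).ran ≤ Q.normalizer.toSubgroup := by
      intro z hz
      obtain ⟨x, hxz, hx⟩ := mem_ran.1 hz
      have hzN := mem_normalizer_ran (mem_normalizer_of_le hΔ.isFunctional hφΔ hxz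
        (dom_graph φ ▸ hx.1))
      rwa [hφ.ran_graph] at hzN
    obtain ⟨ψ, hψ, hψΔ⟩ := hF.exists_mem_hom (hF.isGraph_restrict hΔ (extender φ))
      (dom_restrict hdom) hran
    refine ⟨ψ, hψ, fun r => apply_eq_of_mem_graph ?_⟩
    rw [hψΔ]
    exact ⟨hφΔ (apply_mem_graph φ r), le_extender φ r⟩

end Receptive

end SubgroupCategory

theorem exists_monoidHom_smul {M N X Y : Type*} [Monoid M] [MulAction M X] [Monoid N]
    [MulAction N Y] [FaithfulSMul N Y] {α : X → Y} (hα : Function.Surjective α)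
    (h : ∀ m : M, ∃ n : N, ∀ x, n • α x = α (m • x)) :
    ∃ f : M →* N, ∀ m x, f m • α x = α (m • x) := by
  choose f hf using h
  refine ⟨{ toFun := f, map_one' := ?_, map_mul' := fun m m' => ?_ }, hf⟩ <;>
    refine FaithfulSMul.eq_of_smul_eq_smul fun y : Y => ?_ <;> obtain ⟨x, rfl⟩ := hα y
  · rw [hf, one_smul, one_smul]
  · rw [mul_smul, hf, hf, hf, mul_smul]

theorem isTopologicalGroup_of_compactSpace {G : Type*} [Group G] [TopologicalSpace G]
    [ContinuousMul G] [CompactSpace G] [T2Space G] : IsTopologicalGroup G where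
  continuous_inv := by
    let e : Gˣ ≃ₜ G := Continuous.homeoOfEquivCompactToT2 (f := toUnits.symm.toEquiv)
      Units.continuous_val
    have h : (fun x : G => x⁻¹) = e ∘ (fun x => x⁻¹) ∘ e.symm := by
      funext x
      change _ = ((toUnits x)⁻¹ : Gˣ).val
      simp
    rw [h]
    fun_prop

namespace SubgroupCategory

open GroupRel

section AutomorphismGroup

variable {S : Type u} [Group S] [TopologicalSpace S] {F : SubgroupCategory S}
  {P Q : ClosedSubgroup S}

/-- An element of `Aut_F(Q)` as a continuous homomorphism. -/
def autToHom (e : F.aut Q) : Q →ₜ* Q where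
  toMonoidHom := (e : MulAut Q).toMonoidHom
  continuous_toFun := F.continuous_aut e

theorem autToHom_mem (e : F.aut Q) : autToHom e ∈ F.Hom Q Q := by
  obtain ⟨φ, hφ, hφe⟩ := e.2.1
  convert hφ
  exact ContinuousMonoidHom.ext fun a => (hφe a).symm

theorem isIso_autToHom (e : F.aut Q) : F.IsIso (autToHom e) :=
  ⟨autToHom_mem e, autToHom e⁻¹, autToHom_mem e⁻¹, fun a => inv_smul_smul e a,
    fun a => smul_inv_smul e a⟩

theorem IsIso.comp {R : ClosedSubgroup S} {φ : P →ₜ* Q} {ψ : Q →ₜ* R} (hψ : F.IsIso ψ)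
    (hφ : F.IsIso φ) : F.IsIso (ψ.comp φ) := by
  obtain ⟨hφ, φ', hφ', hφ'φ, hφφ'⟩ := hφ
  obtain ⟨hψ, ψ', hψ', hψ'ψ, hψψ'⟩ := hψ
  refine ⟨F.comp_mem hφ hψ, φ'.comp ψ', F.comp_mem hψ' hφ', fun a => ?_, fun a => ?_⟩
  · exact (congrArg φ' (hψ'ψ (φ a))).trans (hφ'φ a)
  · exact (congrArg ψ (hφφ' (ψ' a))).trans (hψψ' a)

theorem IsIso.exists_aut {φ : Q →ₜ* Q} (hφ : F.IsIso φ) : ∃ e : F.aut Q, ∀ a, e • a = φ a := by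
  obtain ⟨hφ, ψ, hψ, hψφ, hφψ⟩ := hφ
  exact ⟨⟨⟨⟨φ, ψ, hψφ, hφψ⟩, map_mul φ⟩, ⟨φ, hφ, fun _ => rfl⟩, ψ, hψ, fun _ => rfl⟩, fun _ => rfl⟩

theorem IsIso.exists_autCongr {φ : P →ₜ* Q} (hφ : F.IsIso φ) :
    ∃ f : F.aut P ≃* F.aut Q, ∀ e a, f e • φ a = φ (e • a) := by
  obtain ⟨ψ, hψ, hψφ, hφψ⟩ : ∃ ψ, F.IsIso ψ ∧ (∀ a, ψ (φ a) = a) ∧ ∀ b, φ (ψ b) = b := by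
    obtain ⟨hφ, ψ, hψ, hψφ, hφψ⟩ := hφ
    exact ⟨ψ, ⟨hψ, φ, hφ, hφψ, hψφ⟩, hψφ, hφψ⟩
  obtain ⟨f, hf⟩ := exists_monoidHom_smul (M := F.aut P) (N := F.aut Q) (α := φ)
    (Function.RightInverse.surjective hφψ) fun e => by
      obtain ⟨e', he'⟩ := (hφ.comp ((isIso_autToHom e).comp hψ)).exists_aut
      exact ⟨e', fun a => (he' _).trans (congrArg (fun b => φ (e • b)) (hψφ a))⟩
  obtain ⟨f', hf'⟩ := exists_monoidHom_smul (M := F.aut Q) (N := F.aut P) (α := ψ)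
    (Function.RightInverse.surjective hψφ) fun e => by
      obtain ⟨e', he'⟩ := (hψ.comp ((isIso_autToHom e).comp hφ)).exists_aut
      exact ⟨e', fun a => (he' _).trans (congrArg (fun b => ψ (e • b)) (hφψ a))⟩
  refine ⟨f.toMulEquiv f' (MonoidHom.ext fun e => ?_) (MonoidHom.ext fun e => ?_), hf⟩
  · refine FaithfulSMul.eq_of_smul_eq_smul fun a : P => ?_
    change f' (f e) • a = e • a
    rw [← hψφ a, hf', hf, hψφ, hψφ]
  · refine FaithfulSMul.eq_of_smul_eq_smul fun b : Q => ?_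
    change f (f' e) • b = e • b
    rw [← hφψ b, hf, hf', hφψ, hφψ]

theorem ext_smul {e e' : F.aut Q} (h : ∀ a : Q, ((e • a : Q) : S) = (e' • a : Q)) : e = e' :=
  FaithfulSMul.eq_of_smul_eq_smul fun a : Q => Subtype.ext (h a)

/-- The homomorphism `f : Aut_F(Q) → Aut_E(A)` is induced by `α : S → T`. This determines `f` if
`A` is the image of `Q`. -/
def IsAutHomInducedBy {T : Type v} [Group T] [TopologicalSpace T] {E : SubgroupCategory T}
    {A : ClosedSubgroup T} (α : S →* T) (f : F.aut Q →* E.aut A) : Prop :=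
  ∀ e (a : Q) (b : A), (b : T) = α a → ((f e • b : A) : T) = α (e • a : Q)

theorem IsAutHomInducedBy.comp {T : Type v} [Group T] [TopologicalSpace T] {X : Type w} [Group X]
    [TopologicalSpace X] {E : SubgroupCategory T} {A : ClosedSubgroup T} {H : SubgroupCategory X}
    {B : ClosedSubgroup X} {α : S →* T} {β : T →* X} {f : F.aut Q →* E.aut A}
    {f' : E.aut A →* H.aut B} (hf' : IsAutHomInducedBy β f') (hf : IsAutHomInducedBy α f)
    (hA : Q.toSubgroup.map α ≤ A.toSubgroup) : IsAutHomInducedBy (β.comp α) (f'.comp f) :=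
  fun e a b hba => by
    have haA : α a ∈ A := hA (Subgroup.mem_map_of_mem α a.2)
    exact (hf' (f e) ⟨α a, haA⟩ b hba).trans (congrArg β (hf e a ⟨α a, haA⟩ rfl))

theorem IsFusionSystem.exists_autHom_of_map {T : Type v} [Group T] [TopologicalSpace T]
    [CompactSpace T] [T2Space T] {E : SubgroupCategory T}
    (hE : E.IsFusionSystem) {α : S →* T} (hα : ∀ Γ, F.IsGraph Γ → E.IsGraph (Γ.image α))
    {A : ClosedSubgroup T} (hA : A.toSubgroup = Q.toSubgroup.map α) :
    ∃ f : F.aut Q →* E.aut A, IsAutHomInducedBy α f := by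
  let β : Q → A := fun a => ⟨α a, hA.ge (Subgroup.mem_map_of_mem α a.2)⟩
  have hβ : Function.Surjective β := fun ⟨b, hb⟩ => by
    obtain ⟨a, ha, rfl⟩ := hA.le hb
    exact ⟨⟨a, ha⟩, rfl⟩
  obtain ⟨f, hf⟩ := exists_monoidHom_smul (M := F.aut Q) (N := E.aut A) hβ fun e => by
    obtain ⟨φ, hφ, hφe⟩ := hE.exists_isIso (hα _ (isGraph_of_mem (autToHom_mem e)))
      (P := A) (Q := A) (by rw [dom_image, dom_graph, hA])
      (by rw [ran_image, (isIso_autToHom e).ran_graph, hA])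
    obtain ⟨e', he'⟩ := hφ.exists_aut
    refine ⟨e', fun a => (he' _).trans (Subtype.ext (apply_eq_of_mem_graph ?_))⟩
    rw [hφe]
    exact mem_image.2 ⟨a, _, apply_mem_graph (autToHom e) a, rfl, rfl⟩
  refine ⟨f, fun e a b hab => ?_⟩
  obtain rfl : b = β a := Subtype.ext hab
  rw [hf]

theorem IsFusionSystem.exists_conjHom [CompactSpace S] [T2Space S] [IsTopologicalGroup S]
    (hF : F.IsFusionSystem) (Q : ClosedSubgroup S) :
    ∃ c : 𝐍(Q.toSubgroup) →* F.aut Q,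
      (∀ s a, ((c s • a : Q) : S) = s * a * (s : S)⁻¹) ∧ c.range = F.autInner Q ∧
        Continuous c := by
  obtain ⟨c, hc⟩ := exists_monoidHom_smul (M := 𝐍(Q.toSubgroup)) (N := F.aut Q)
    (X := Q.toSubgroup) (Y := Q) (α := id) Function.surjective_id fun s => by
      obtain ⟨φ, hφ, hφs⟩ := hF.exists_isIso (hF.isGraph_conj Q s) (P := Q) (Q := Q)
        (dom_conj _ _) (ran_conj s.2)
      obtain ⟨e, he⟩ := hφ.exists_aut
      refine ⟨e, fun a => (he a).trans (Subtype.ext (apply_eq_of_mem_graph ?_))⟩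
      rw [hφs]
      exact mem_conj.2 ⟨a.2, rfl⟩
  have hc' : ∀ s a, ((c s • a : Q) : S) = s * a * (s : S)⁻¹ := fun s a =>
    congrArg Subtype.val (hc s a)
  refine ⟨c, hc', Subgroup.ext fun e => ⟨?_, ?_⟩, continuous_induced_rng.2 <|
    ContinuousMap.continuous_of_continuous_uncurry _ (continuous_induced_rng.2 ?_)⟩
  · rintro ⟨s, rfl⟩
    exact ⟨s, s.2, hc' s⟩
  · rintro ⟨s, hs, hse⟩
    exact ⟨⟨s, hs⟩, ext_smul fun a => (hc' _ a).trans (hse a).symm⟩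
  · have hcs : Continuous fun z : 𝐍(Q.toSubgroup) × Q => (z.1 : S) * z.2 * (z.1 : S)⁻¹ := by
      fun_prop
    exact hcs.congr fun z => (hc' z.1 z.2).symm

theorem continuous_autToMap (Q : ClosedSubgroup S) : Continuous (F.autToMap (P := Q)) :=
  continuous_induced_dom (t := ContinuousMap.compactOpen)

theorem injective_autToMap (Q : ClosedSubgroup S) :
    Function.Injective (F.autToMap (P := Q)) := fun _ _ h =>
  ext_smul fun a => congrArg Subtype.val (DFunLike.congr_fun h a)

theorem t2Space_aut [T2Space S] (Q : ClosedSubgroup S) : T2Space (F.aut Q) :=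
  .of_injective_continuous (injective_autToMap Q) (continuous_autToMap Q)

theorem continuousMul_aut [CompactSpace S] [T2Space S] (Q : ClosedSubgroup S) :
    ContinuousMul (F.aut Q) := by
  have : CompactSpace Q := isCompact_iff_compactSpace.mp Q.isClosed'.isCompact
  exact ⟨continuous_induced_rng.2 <| ((continuous_autToMap Q).comp continuous_fst).compCM
    ((continuous_autToMap Q).comp continuous_snd)⟩

theorem totallyDisconnectedSpace_aut [TotallyDisconnectedSpace S] (Q : ClosedSubgroup S) :
    TotallyDisconnectedSpace (F.aut Q) := by
  have hc : Continuous fun (e : F.aut Q) (a : Q) => e • a :=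
    continuous_pi fun a => (continuous_eval_const (F := C(Q, Q)) a).comp (continuous_autToMap Q)
  exact ⟨isTotallyDisconnected_of_image hc.continuousOn
    (fun e e' h => ext_smul fun a => congrArg Subtype.val (congrFun h a))
    (isTotallyDisconnected_of_totallyDisconnectedSpace _)⟩

theorem discreteTopology_aut [DiscreteTopology S] [Finite S] (Q : ClosedSubgroup S) :
    DiscreteTopology (F.aut Q) := by
  have := t2Space_aut (F := F) Q
  infer_instance

end AutomorphismGroup

section FiniteSaturated

variable {S : Type u} [Group S] [TopologicalSpace S] [IsTopologicalGroup S] [CompactSpace S]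
  [T2Space S] {F : SubgroupCategory S} {P Q : ClosedSubgroup S} {p : ℕ}

theorem IsFusionSystem.isPGroup_autInner (hF : F.IsFusionSystem) (hS : IsPGroup p S)
    (Q : ClosedSubgroup S) : IsPGroup p (F.autInner Q) := by
  obtain ⟨c, -, hrange, -⟩ := hF.exists_conjHom Q
  rw [← hrange]
  exact (hS.to_subgroup _).of_surjective c.rangeRestrict c.rangeRestrict_surjective

theorem IsFusionSystem.exists_isIso_map_autInner_le [Fact p.Prime] [Finite (F.aut Q)]
    (hF : F.IsFusionSystem) (hS : IsPGroup p S) (hQ : ¬ p ∣ (F.autInner Q).index)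
    (hPQ : ∃ φ : P →ₜ* Q, F.IsIso φ) :
    ∃ φ : P →ₜ* Q, F.IsIso φ ∧ ∃ f : F.aut P →* F.aut Q,
      (∀ e a, f e • φ a = φ (e • a)) ∧ (F.autInner P).map f ≤ F.autInner Q := by
  obtain ⟨φ, hφ⟩ := hPQ
  obtain ⟨f, hf⟩ := hφ.exists_autCongr
  obtain ⟨T, hT⟩ := ((hF.isPGroup_autInner hS P).map f.toMonoidHom).exists_le_sylow
  obtain ⟨e, he⟩ := MulAction.exists_smul_eq (F.aut Q) T ((hF.isPGroup_autInner hS Q).toSylow hQ)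
  refine ⟨_, (isIso_autToHom e).comp hφ, (MulAut.conj e).toMonoidHom.comp f.toMonoidHom,
    fun e' a => ?_, ?_⟩
  · change (e * f e' * e⁻¹) • e • φ a = e • φ (e' • a)
    rw [smul_smul, inv_mul_cancel_right, mul_smul, hf]
  · rw [← Subgroup.map_map]
    have heT := congrArg (Sylow.toSubgroup) he
    exact (Subgroup.map_mono hT).trans heT.le

theorem IsFusionSystem.normalizer_le_dom_normalizer_graph (hF : F.IsFusionSystem) {φ : P →ₜ* Q}
    {f : F.aut P →* F.aut Q} (hf : ∀ e a, f e • φ a = φ (e • a))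
    (hPQ : (F.autInner P).map f ≤ F.autInner Q) :
    𝐍(P.toSubgroup) ≤ GroupRel.dom 𝐍(graph φ) := by
  intro s hs
  obtain ⟨c, hc, hrange, -⟩ := hF.exists_conjHom P
  obtain ⟨t, -, ht⟩ := hPQ (Subgroup.mem_map_of_mem f (hrange.le ⟨⟨s, hs⟩, rfl⟩))
  refine mem_dom.2 ⟨t, mem_normalizer_of_forall (isFunctional_graph φ) ?_ fun x y hxy => ?_⟩
  · rwa [dom_graph]
  · obtain ⟨a, rfl, rfl⟩ := mem_graph.1 hxy
    exact mem_graph.2 ⟨c ⟨s, hs⟩ • a, hc _ a,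
      (congrArg Subtype.val (hf _ a)).symm.trans (ht (φ a))⟩

omit [IsTopologicalGroup S] [CompactSpace S] [T2Space S] in
theorem IsFullyAutomized.not_dvd_index_autInner [DiscreteTopology S] [Finite S]
    (hQ : F.IsFullyAutomized p Q) : ¬ p ∣ (F.autInner Q).index := by
  have := discreteTopology_aut (F := F) Q
  have hindex := hQ.not_dvd_index ⊥ inferInstance (isOpen_discrete _)
  rwa [sup_bot_eq] at hindex

theorem IsSaturated.exists_isGraph_extending_normalizer [DiscreteTopology S] [Finite S]
    [Fact p.Prime] (hF : F.IsSaturated p) (hF' : F.IsFusionSystem) (hS : IsPGroup p S)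
    (P : ClosedSubgroup S) :
    ∃ (Q : ClosedSubgroup S) (Δ : GroupRel S S), F.IsReceptive Q ∧ ¬ p ∣ (F.autInner Q).index ∧
      F.IsGraph Δ ∧ 𝐍(P.toSubgroup) ≤ Δ.dom ∧ (Δ.restrict P.toSubgroup).ran = Q.toSubgroup := by
  obtain ⟨Q, hPQ, hrec, haut⟩ := hF P
  have hindex := haut.not_dvd_index_autInner
  obtain ⟨φ, hφ, f, hf, hfPQ⟩ := hF'.exists_isIso_map_autInner_le hS hindex hPQ
  obtain ⟨Δ, hΔ, hφΔ, hN⟩ := hF'.isReceptive_iff.1 hrec _ (isGraph_of_mem hφ.1) hφ.ran_graph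
  refine ⟨Q, Δ, hrec, hindex, hΔ, (hF'.normalizer_le_dom_normalizer_graph hf hfPQ).trans hN, ?_⟩
  rw [← dom_graph φ, hΔ.isFunctional.restrict_dom_of_le hφΔ, hφ.ran_graph]

end FiniteSaturated

section NormalizerLimit

variable {p : ℕ} {I : Type w} [PartialOrder I] {S : Type u} [Group S] [TopologicalSpace S]
  {F : SubgroupCategory S} {D : FusionInverseSystem.{v, w} p I} {g : ∀ i, S →* D.grp i}
  {J : Type x} {ℓ : J → I} {U : Ultrafilter J} {Q : ClosedSubgroup S} {χ : GroupRel S S}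
  {Δ : ∀ a, GroupRel (D.grp (ℓ a)) (D.grp (ℓ a))} {B : ∀ a, ClosedSubgroup (D.grp (ℓ a))}

/-- The morphism `χ` of `F` is the limit of morphisms `Δ a` of the categories `D.fus (ℓ a)` which
are defined on the normalizer of the image of `Q`, and send the image of `Q` onto `B a`. -/
structure IsNormalizerLimit (F : SubgroupCategory S) (D : FusionInverseSystem.{v, w} p I)
    (g : ∀ i, S →* D.grp i) {ℓ : J → I} (U : Ultrafilter J) (Q : ClosedSubgroup S)
    (χ : GroupRel S S) (Δ : ∀ a, GroupRel (D.grp (ℓ a)) (D.grp (ℓ a)))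
    (B : ∀ a, ClosedSubgroup (D.grp (ℓ a))) : Prop where
  tendsto : Filter.Tendsto ℓ U Filter.atTop
  isGraph : F.IsGraph χ
  isGraph_level : ∀ a, (D.fus (ℓ a)).IsGraph (Δ a)
  isRelLevelLimit : IsRelLevelLimit D.transition g U χ Δ
  normalizer_le_dom_level : ∀ a, 𝐍(Q.toSubgroup.map (g (ℓ a))) ≤ (Δ a).dom
  ran_restrict_level : ∀ a, ((Δ a).restrict (Q.toSubgroup.map (g (ℓ a)))).ran = (B a).toSubgroup

namespace IsNormalizerLimit

theorem le_dom_level (hN : IsNormalizerLimit F D g U Q χ Δ B) (a : J) :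
    Q.toSubgroup.map (g (ℓ a)) ≤ (Δ a).dom :=
  Subgroup.le_normalizer.trans (hN.normalizer_le_dom_level a)

variable [CompactSpace S] [T2Space S] [Nonempty I] [IsDirectedOrder I]
  (hN : IsNormalizerLimit F D g U Q χ Δ B) (h : IsFusionLimit F D g)
include hN h

theorem normalizer_le_dom : 𝐍(Q.toSubgroup) ≤ χ.dom :=
  h.isGroupLimit.le_of_isLevelLimit (isClosed_dom hN.isGraph.isClosed)
    (h.isGroupLimit.isLevelLimit_map hN.tendsto _) hN.isRelLevelLimit.dom
    (.of_forall fun a => (Subgroup.le_normalizer_map _).trans (hN.normalizer_le_dom_level a))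

theorem isRelLevelLimit_restrict :
    IsRelLevelLimit D.transition g U (χ.restrict Q.toSubgroup)
      (fun a => (Δ a).restrict (Q.toSubgroup.map (g (ℓ a)))) := by
  obtain ⟨χ₀, hχ₀, hlim⟩ := h.exists_isGraph_isLevelLimit hN.tendsto fun a =>
    (D.isFusionSystem (ℓ a)).isGraph_restrict (hN.isGraph_level a)
      ⟨Q.toSubgroup.map (g (ℓ a)), isClosed_discrete _⟩
  have hle : χ₀ ≤ χ := h.isGroupLimit.prod.le_of_isLevelLimit hN.isGraph.isClosed hlim
    hN.isRelLevelLimit (.of_forall fun a => restrict_le _ _)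
  have hdom : χ₀.dom = Q.toSubgroup := by
    refine h.isGroupLimit.eq_of_isLevelLimit (isClosed_dom hχ₀.isClosed) Q.isClosed' hlim.dom ?_
    simp only [dom_restrict (hN.le_dom_level _)]
    exact h.isGroupLimit.isLevelLimit_map hN.tendsto _
  have hrestrict := hN.isGraph.isFunctional.restrict_dom_of_le hle
  rw [hdom] at hrestrict
  rwa [hrestrict]

variable {Γ Λ : GroupRel S S} {Θ : ∀ a, GroupRel (D.grp (ℓ a)) (D.grp (ℓ a))}

theorem comp_restrict_le (hΛ : IsClosed (Λ : Set (S × S)))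
    (hlim : IsRelLevelLimit D.transition g U Λ Θ)
    (hle : ∀ a, (Γ.image (g (ℓ a))).comp ((Δ a).restrict (Q.toSubgroup.map (g (ℓ a)))) ≤ Θ a) :
    Γ.comp (χ.restrict Q.toSubgroup) ≤ Λ := by
  rintro ⟨x, z⟩ ⟨y, hxy, hyz⟩
  refine h.isGroupLimit.prod.mem_of_forall hΛ fun i => ?_
  obtain ⟨a, ⟨hi, hχa⟩, _, hΛa⟩ := ((hN.isRelLevelLimit_restrict h i).and (hlim i)).exists
  have hy : g (ℓ a) y ∈ Q.toSubgroup.map (g (ℓ a)) := Subgroup.mem_map_of_mem _ hyz.2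
  obtain ⟨b, hb⟩ := mem_dom.1 (hN.le_dom_level a hy)
  have hyb := hχa.ge (mem_image.2 ⟨_, b, ⟨hb, hy⟩, rfl, rfl⟩)
  have hxb := hΛa.ge (mem_image.2 ⟨_, b, hle a ⟨_, mem_image.2 ⟨x, y, hxy, rfl, rfl⟩, hb, hy⟩,
    rfl, rfl⟩)
  have hbz : D.transition i (ℓ a) hi b = g i z := by
    rw [h.isGroupLimit.map_apply hi] at hyb
    exact (h.isGraph_image hN.isGraph i).isFunctional.eq
      (Subgroup.map_mono (restrict_le _ _) hyb) (mem_image.2 ⟨y, z, hyz.1, rfl, rfl⟩)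
  rw [h.isGroupLimit.map_apply hi, hbz] at hxb
  exact hxb

omit [T2Space S] in
theorem dom_normalizer_le (hΛ : IsClosed (Λ : Set (S × S)))
    (hlim : IsRelLevelLimit D.transition g U Λ Θ)
    (hle : ∀ a, GroupRel.dom 𝐍((Γ.image (g (ℓ a))).comp
      ((Δ a).restrict (Q.toSubgroup.map (g (ℓ a))))) ≤ (Θ a).dom)
    (hΓ : Γ.ran = Q.toSubgroup) : GroupRel.dom 𝐍(Γ) ≤ Λ.dom := by
  refine h.isGroupLimit.le_of_isLevelLimit (isClosed_dom hΛ)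
    (h.isGroupLimit.isLevelLimit_map hN.tendsto _) hlim.dom (.of_forall fun a => ?_)
  rintro _ ⟨x, hx, rfl⟩
  obtain ⟨y, hxy⟩ := mem_dom.1 hx
  have hxy' : (g (ℓ a) x, g (ℓ a) y) ∈ 𝐍(Γ.image (g (ℓ a))) :=
    Subgroup.le_normalizer_map _ (Subgroup.mem_map_of_mem _ hxy)
  have hy : g (ℓ a) y ∈ 𝐍(Q.toSubgroup.map (g (ℓ a))) := by
    rw [← hΓ]
    exact Subgroup.le_normalizer_map _ (Subgroup.mem_map_of_mem _ (mem_normalizer_ran hxy))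
  obtain ⟨z, hyz⟩ := mem_dom.1 (hN.normalizer_le_dom_level a hy)
  exact hle a (mem_dom.2 ⟨z, mem_normalizer_comp hxy' (mem_normalizer_restrict hyz hy)⟩)

theorem exists_isGraph_comp_le (hB : ∀ a, (D.fus (ℓ a)).IsReceptive (B a)) (hΓ : F.IsGraph Γ)
    (hΓQ : Γ.ran = Q.toSubgroup) :
    ∃ Λ, F.IsGraph Λ ∧ Γ.comp (χ.restrict Q.toSubgroup) ≤ Λ ∧ GroupRel.dom 𝐍(Γ) ≤ Λ.dom := by
  have hlevel : ∀ a, ∃ Θ, (D.fus (ℓ a)).IsGraph Θ ∧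
      (Γ.image (g (ℓ a))).comp ((Δ a).restrict (Q.toSubgroup.map (g (ℓ a)))) ≤ Θ ∧
      GroupRel.dom 𝐍((Γ.image (g (ℓ a))).comp
        ((Δ a).restrict (Q.toSubgroup.map (g (ℓ a))))) ≤ Θ.dom := fun a => by
    have hfus := D.isFusionSystem (ℓ a)
    refine hfus.isReceptive_iff.1 (hB a) _ (hfus.isGraph_comp (h.isGraph_image hΓ _)
      (hfus.isGraph_restrict (hN.isGraph_level a) ⟨_, isClosed_discrete _⟩)) ?_
    rw [ran_comp, hN.ran_restrict_level]
    rw [dom_restrict (hN.le_dom_level a), ran_image, hΓQ]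
  choose Θ hΘ hΘle hΘN using hlevel
  obtain ⟨Λ, hΛ, hlim⟩ := h.exists_isGraph_isLevelLimit hN.tendsto hΘ
  exact ⟨Λ, hΛ, hN.comp_restrict_le h hΛ.isClosed hlim hΘle,
    hN.dom_normalizer_le h hΛ.isClosed hlim hΘN hΓQ⟩

theorem isReceptive [IsTopologicalGroup S] (hmax : F.IsNormalizerMaximal Q.toSubgroup)
    (hB : ∀ a, (D.fus (ℓ a)).IsReceptive (B a)) : F.IsReceptive Q := by
  have hF := h.isFusionSystem
  have hdom := hN.normalizer_le_dom h
  refine hF.isReceptive_iff.2 fun Γ hΓ hΓQ => ?_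
  obtain ⟨Λ, hΛ, hle, hΛN⟩ := hN.exists_isGraph_comp_le h hB hΓ hΓQ
  have hQ : Q.toSubgroup ≤ χ.dom := Subgroup.le_normalizer.trans hdom
  refine ⟨_, hF.isGraph_comp hΛ (hF.isGraph_inv hN.isGraph), ?_, fun x hx => ?_⟩
  · rintro ⟨x, y⟩ hxy
    have hy : y ∈ Q.toSubgroup := hΓQ ▸ mem_ran.2 ⟨x, hxy⟩
    obtain ⟨z, hyz⟩ := mem_dom.1 (hQ hy)
    exact mem_comp.2 ⟨z, hle (mem_comp.2 ⟨y, hxy, hyz, hy⟩), mem_inv.2 hyz⟩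
  · obtain ⟨y, hxy⟩ := mem_dom.1 hx
    obtain ⟨z, hxz⟩ := mem_dom.1 (hΛN hx)
    have hdomΓ : (Γ.comp (χ.restrict Q.toSubgroup)).dom = Γ.dom :=
      dom_comp (by rw [dom_restrict hQ, hΓQ])
    have hranΓ : (Γ.comp (χ.restrict Q.toSubgroup)).ran = (χ.restrict Q.toSubgroup).ran :=
      ran_comp (by rw [dom_restrict hQ, hΓQ])
    have hz := mem_normalizer_ran (mem_normalizer_of_le hΛ.isFunctional hle hxz
      (hdomΓ.symm ▸ mem_normalizer_dom hxy))
    rw [hranΓ] at hz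
    obtain ⟨w, hwz⟩ := mem_ran.1 (hmax hN.isGraph hdom hz)
    exact mem_dom.2 ⟨w, mem_comp.2 ⟨z, hxz, mem_inv.2 hwz.1⟩⟩

end IsNormalizerLimit

end NormalizerLimit

section AutInner

variable {p : ℕ} {I : Type w} [PartialOrder I] [Nonempty I] [IsDirectedOrder I] {S : Type u}
  [Group S] [TopologicalSpace S] [CompactSpace S] [T2Space S] {F : SubgroupCategory S}
  {D : FusionInverseSystem.{v, w} p I} {g : ∀ i, S →* D.grp i} {Q : ClosedSubgroup S}

theorem IsFusionLimit.exists_forall_mem_of_isOpen (h : IsFusionLimit F D g) {V : Set (F.aut Q)}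
    (hV : IsOpen V) (h1 : 1 ∈ V) :
    ∃ i, ∀ e : F.aut Q, (∀ a : Q, g i (e • a : Q) = g i a) → e ∈ V := by
  have hQ : CompactSpace Q := isCompact_iff_compactSpace.mp Q.isClosed'.isCompact
  by_contra! hcon
  choose e he heV using hcon
  have hlim : Filter.Tendsto (fun i => F.autToMap (e i)) Filter.atTop (nhds (F.autToMap 1)) := by
    refine ContinuousMap.tendsto_nhds_compactOpen.2 fun K hK W hW hKW => ?_
    obtain ⟨i, hi⟩ := h.isGroupLimit.exists_forall_mem_of_subset
      (hK.image continuous_subtype_val).isClosed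
      (hW.isClosed_compl.isCompact.image continuous_subtype_val).isClosed.isOpen_compl
      (K := Subtype.val '' K) (W := (Subtype.val '' Wᶜ)ᶜ) <| by
        rintro _ ⟨a, ha, rfl⟩ ⟨b, hb, hba⟩
        obtain rfl : b = a := Subtype.ext hba
        exact hb (hKW ha)
    filter_upwards [Filter.eventually_ge_atTop i] with j hij a ha
    by_contra hea
    refine hi a ⟨a, ha, rfl⟩ (e j • a : Q) ?_ ⟨_, hea, rfl⟩
    rw [← h.isGroupLimit.map_apply hij, ← he j a, h.isGroupLimit.map_apply hij]
  have hV1 := hV.mem_nhds h1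
  rw [nhds_induced] at hV1
  obtain ⟨W, hW, hWV⟩ := hV1
  obtain ⟨i, hi⟩ := (hlim.eventually hW).exists
  exact heV i (hWV hi)

variable [IsTopologicalGroup S]

theorem IsFusionSystem.isCompact_autInner (hF : F.IsFusionSystem) (Q : ClosedSubgroup S) :
    IsCompact (F.autInner Q : Set (F.aut Q)) := by
  obtain ⟨c, -, hrange, hcont⟩ := hF.exists_conjHom Q
  have hN : CompactSpace 𝐍(Q.toSubgroup) :=
    isCompact_iff_compactSpace.mp Q.normalizer.isClosed'.isCompact
  rw [← hrange]
  exact isCompact_range hcont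

theorem IsFusionLimit.isPGroup_quotient_autInner (h : IsFusionLimit F D g)
    {V : Subgroup (F.autInner Q)} [V.Normal] (hV : IsOpen (V : Set (F.autInner Q))) :
    IsPGroup p (F.autInner Q ⧸ V) := by
  obtain ⟨c, hc, hrange, -⟩ := h.isFusionSystem.exists_conjHom Q
  obtain ⟨W, hW, hWV⟩ := isOpen_induced_iff.1 hV
  obtain ⟨i, hi⟩ := h.exists_forall_mem_of_isOpen hW (hWV.ge (one_mem V))
  intro e
  obtain ⟨⟨e, he⟩, rfl⟩ := QuotientGroup.mk_surjective e
  obtain ⟨s, rfl⟩ := hrange.ge he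
  obtain ⟨k, hk⟩ := D.isPGroup i (g i s)
  refine ⟨k, ?_⟩
  rw [← QuotientGroup.mk_pow, QuotientGroup.eq_one_iff]
  refine hWV.le (show c s ^ p ^ k ∈ W from ?_)
  rw [← map_pow]
  refine hi _ fun a => ?_
  rw [hc, map_mul, map_mul, map_inv, Subgroup.coe_pow, map_pow, hk, one_mul, inv_one, mul_one]

theorem IsFusionLimit.isProPGroup_autInner [TotallyDisconnectedSpace S] (h : IsFusionLimit F D g)
    (Q : ClosedSubgroup S) : IsProPGroup p (F.autInner Q) := by
  have hT2 := t2Space_aut (F := F) Q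
  have hmul := continuousMul_aut (F := F) Q
  have htd := totallyDisconnectedSpace_aut (F := F) Q
  have hcompact : CompactSpace (F.autInner Q) :=
    isCompact_iff_compactSpace.mp (h.isFusionSystem.isCompact_autInner Q)
  have hmul' : ContinuousMul (F.autInner Q) := (F.autInner Q).toSubmonoid.continuousMul
  exact ⟨isTopologicalGroup_of_compactSpace, hcompact, inferInstance,
    fun _ _ => h.isPGroup_quotient_autInner⟩

end AutInner

end SubgroupCategory

theorem relIndex_map_range {G L : Type*} [Group G] [Group L] (f : G →* L) (H : Subgroup G) :
    (H.map f).relIndex f.range = (H ⊔ f.ker).index := by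
  rw [MonoidHom.range_eq_map, Subgroup.relIndex_map_map, top_sup_eq, Subgroup.relIndex_top_right]

theorem index_sup_dvd_index_of_map_le {G K L : Type*} [Group G] [Group K] [Group L] {ρ : G →* L}
    {θ : K →* L} {X : Subgroup K} {Y V : Subgroup G} (hV : ρ.ker ≤ V) (hρθ : ρ.range ≤ θ.range)
    (hXY : X.map θ ≤ Y.map ρ) : (Y ⊔ V).index ∣ X.index :=
  calc (Y ⊔ V).index ∣ (Y ⊔ ρ.ker).index := Subgroup.index_dvd_of_le (sup_le_sup_left hV Y)
    _ = (Y.map ρ).relIndex ρ.range := (relIndex_map_range ρ Y).symm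
    _ ∣ (Y.map ρ).relIndex θ.range :=
      Dvd.intro _ (Subgroup.relIndex_mul_relIndex _ _ _ (Subgroup.map_le_range ρ Y) hρθ)
    _ ∣ (X.map θ).relIndex θ.range := Subgroup.relIndex_dvd_of_le_left _ hXY
    _ = (X ⊔ θ.ker).index := relIndex_map_range θ X
    _ ∣ X.index := Subgroup.index_dvd_of_le le_sup_left

namespace SubgroupCategory

open GroupRel

namespace IsNormalizerLimit

variable {p : ℕ} {I : Type w} [PartialOrder I] [Nonempty I] [IsDirectedOrder I] {S : Type u}
  [Group S] [TopologicalSpace S] [CompactSpace S] [T2Space S] {F : SubgroupCategory S}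
  {D : FusionInverseSystem.{v, w} p I} {g : ∀ i, S →* D.grp i}
  {J : Type x} {ℓ : J → I} {U : Ultrafilter J} {Q : ClosedSubgroup S} {χ : GroupRel S S}
  {Δ : ∀ a, GroupRel (D.grp (ℓ a)) (D.grp (ℓ a))} {B : ∀ a, ClosedSubgroup (D.grp (ℓ a))}

theorem map_autInner_le [IsTopologicalGroup S] (hN : IsNormalizerLimit F D g U Q χ Δ B) {a : J}
    {i : I} {hi : i ≤ ℓ a} (h : IsFusionLimit F D g) (hmax : F.IsNormalizerMaximal Q.toSubgroup)
    (hχ : χ.image (g i) = (Δ a).image (D.transition i (ℓ a) hi))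
    (hB : 𝐍((B a).toSubgroup).map (D.transition i (ℓ a) hi) ≤
      𝐍((χ.restrict Q.toSubgroup).ran).map (g i))
    {A : ClosedSubgroup (D.grp i)} {C : ClosedSubgroup (D.grp (ℓ a))}
    (hA : A.toSubgroup = Q.toSubgroup.map (g i)) (hC : C.toSubgroup = Q.toSubgroup.map (g (ℓ a)))
    {φ : C →ₜ* B a} (hφ : graph φ = (Δ a).restrict C.toSubgroup)
    {ρ : F.aut Q →* (D.fus i).aut A} {τ : (D.fus (ℓ a)).aut C →* (D.fus i).aut A}
    {f : (D.fus (ℓ a)).aut C ≃* (D.fus (ℓ a)).aut (B a)} (hρ : IsAutHomInducedBy (g i) ρ)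
    (hτ : IsAutHomInducedBy (D.transition i (ℓ a) hi) τ) (hf : ∀ e a, f e • φ a = φ (e • a)) :
    ((D.fus (ℓ a)).autInner (B a)).map (τ.comp f.symm.toMonoidHom) ≤ (F.autInner Q).map ρ := by
  obtain ⟨conj, hconj, hrange, -⟩ := h.isFusionSystem.exists_conjHom Q
  rintro _ ⟨e, ⟨y, hy, (hye : ∀ d, ((e • d : B a) : D.grp (ℓ a)) = y * d * y⁻¹)⟩, rfl⟩
  obtain ⟨k, hk, hky⟩ := hB ⟨y, hy, rfl⟩
  obtain ⟨z, hzk, hz⟩ := mem_ran.1 (hmax hN.isGraph (hN.normalizer_le_dom h) hk)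
  refine ⟨conj ⟨z, hz⟩, hrange.le ⟨_, rfl⟩, ext_smul fun c => ?_⟩
  obtain ⟨b, hb, hbc⟩ := hA.le c.2
  have hbC : g (ℓ a) b ∈ C := hC.ge (Subgroup.mem_map_of_mem _ hb)
  have hφχ : ∀ u : C, (D.transition i (ℓ a) hi u, D.transition i (ℓ a) hi (φ u)) ∈ χ.image (g i) :=
    fun u => hχ.ge (mem_image.2 ⟨u, φ u, (hφ.le (apply_mem_graph φ u)).1, rfl, rfl⟩)
  have hzy : (g i z, D.transition i (ℓ a) hi y) ∈ χ.image (g i) :=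
    mem_image.2 ⟨z, k, hzk, rfl, hky⟩
  have hconjz := mul_mem (mul_mem hzy (hφχ ⟨_, hbC⟩)) (inv_mem hzy)
  have hconje := hφχ (f.symm e • ⟨_, hbC⟩)
  rw [← hf, f.apply_symm_apply, hye, map_mul, map_mul, map_inv] at hconje
  have heq : g i z * D.transition i (ℓ a) hi (g (ℓ a) b) * (g i z)⁻¹ =
      D.transition i (ℓ a) hi (f.symm e • ⟨_, hbC⟩ : C) :=
    ((D.isFusionSystem i).isFunctional_inv (h.isGraph_image hN.isGraph i)).eq
      (mem_inv.2 hconjz) (mem_inv.2 hconje)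
  have hτe := hτ (f.symm e) ⟨_, hbC⟩ c (hbc.symm.trans (h.isGroupLimit.map_apply hi b).symm)
  refine Eq.trans ?_ hτe.symm
  rw [hρ _ ⟨b, hb⟩ c hbc.symm, hconj, ← heq, h.isGroupLimit.map_apply, map_mul, map_mul, map_inv]

theorem exists_index_autInner_sup_dvd [IsTopologicalGroup S]
    (hN : IsNormalizerLimit F D g U Q χ Δ B) (h : IsFusionLimit F D g)
    (hmax : F.IsNormalizerMaximal Q.toSubgroup) {V : Subgroup (F.aut Q)}
    (hV : IsOpen (V : Set (F.aut Q))) :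
    ∃ a, (F.autInner Q ⊔ V).index ∣ ((D.fus (ℓ a)).autInner (B a)).index := by
  obtain ⟨i, hi⟩ := h.exists_forall_mem_of_isOpen hV (one_mem V)
  have hR := (hN.isRelLevelLimit_restrict h).ran
  simp only [hN.ran_restrict_level] at hR
  have hRcl : IsClosed ((χ.restrict Q.toSubgroup).ran : Set S) :=
    isClosed_ran (isClosed_restrict hN.isGraph.isClosed Q.isClosed')
  obtain ⟨a, ⟨hia, hχ⟩, _, hB⟩ := ((hN.isRelLevelLimit i).and
    (h.isGroupLimit.eventually_map_normalizer_le hN.tendsto hRcl hR i)).exists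
  have hfus := D.isFusionSystem (ℓ a)
  let A : ClosedSubgroup (D.grp i) := ⟨Q.toSubgroup.map (g i), isClosed_discrete _⟩
  let C : ClosedSubgroup (D.grp (ℓ a)) := ⟨Q.toSubgroup.map (g (ℓ a)), isClosed_discrete _⟩
  obtain ⟨φ, hφ, hφΔ⟩ := hfus.exists_isIso (hfus.isGraph_restrict (hN.isGraph_level a) C) (P := C)
    (Q := B a) (dom_restrict (hN.le_dom_level a)) (hN.ran_restrict_level a)
  obtain ⟨f, hf⟩ := hφ.exists_autCongr
  obtain ⟨σ, hσ⟩ := hfus.exists_autHom_of_map (F := F) (Q := Q) (A := C)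
    (fun Γ hΓ => h.isGraph_image hΓ (ℓ a)) rfl
  obtain ⟨τ, hτ⟩ := (D.isFusionSystem i).exists_autHom_of_map (Q := C) (A := A)
    (fun Γ => FusionInverseSystem.isGraph_transition hia)
    (h.isGroupLimit.map_map_eq hia Q.toSubgroup).symm
  have hτσ := hτ.comp hσ le_rfl
  rw [h.isGroupLimit.map_comp_eq] at hτσ
  refine ⟨a, index_sup_dvd_index_of_map_le (fun e he => hi e fun b => ?_) ?_
    (hN.map_autInner_le h hmax hχ hB rfl rfl hφΔ hτσ hτ hf)⟩
  · rw [← hτσ e b ⟨g i b, Subgroup.mem_map_of_mem _ b.2⟩ rfl, MonoidHom.mem_ker.1 he, one_smul]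
  · rintro _ ⟨e, rfl⟩
    exact ⟨f (σ e), congrArg τ (f.symm_apply_apply (σ e))⟩

theorem isFullyAutomized [IsTopologicalGroup S] [TotallyDisconnectedSpace S]
    (hN : IsNormalizerLimit F D g U Q χ Δ B) (h : IsFusionLimit F D g)
    (hmax : F.IsNormalizerMaximal Q.toSubgroup)
    (hB : ∀ a, ¬ p ∣ ((D.fus (ℓ a)).autInner (B a)).index) : F.IsFullyAutomized p Q := by
  have hT2 := t2Space_aut (F := F) Q
  refine ⟨(h.isFusionSystem.isCompact_autInner Q).isClosed, h.isProPGroup_autInner Q,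
    fun V _ hV hdvd => ?_⟩
  obtain ⟨a, ha⟩ := hN.exists_index_autInner_sup_dvd h hmax hV
  exact hB a (hdvd.trans ha)

end IsNormalizerLimit

theorem IsFusionLimit.exists_isNormalizerLimit {p : ℕ} [Fact p.Prime] {I : Type w} [PartialOrder I]
    [Nonempty I] [IsDirectedOrder I] {S : Type u} [Group S] [TopologicalSpace S] [CompactSpace S]
    {F : SubgroupCategory S} {D : FusionInverseSystem.{v, w} p I} {g : ∀ i, S →* D.grp i}
    (h : IsFusionLimit F D g) (hD : ∀ i, (D.fus i).IsSaturated p)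
    (Q : ClosedSubgroup S) :
    ∃ (U : Ultrafilter I) (χ : GroupRel S S) (Δ : ∀ i, GroupRel (D.grp i) (D.grp i))
      (B : ∀ i, ClosedSubgroup (D.grp i)), IsNormalizerLimit F D g (ℓ := fun i => i) U Q χ Δ B ∧
        (∀ i, (D.fus i).IsReceptive (B i)) ∧ ∀ i, ¬ p ∣ ((D.fus i).autInner (B i)).index := by
  choose B Δ hrec hindex hΔ hdom hran using fun i =>
    (hD i).exists_isGraph_extending_normalizer (D.isFusionSystem i) (D.isPGroup i)
      ⟨Q.toSubgroup.map (g i), isClosed_discrete _⟩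
  have hU : Filter.Tendsto (fun i : I => i) (Ultrafilter.of (α := I) Filter.atTop) Filter.atTop :=
    Filter.tendsto_id'.2 (Ultrafilter.of_le _)
  obtain ⟨χ, hχ, hlim⟩ := h.exists_isGraph_isLevelLimit hU hΔ
  exact ⟨_, χ, Δ, B, ⟨hU, hχ, hΔ, hlim, hdom, hran⟩, hrec, hindex⟩

end SubgroupCategory

theorem mainTheorem3_general (p : ℕ) [Fact p.Prime] {S : Type u} [Group S] [TopologicalSpace S]
    [IsTopologicalGroup S] [CompactSpace S] [T2Space S] [TotallyDisconnectedSpace S]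
    (F : SubgroupCategory S) (hF : SubgroupCategory.IsProSaturated.{u, w, x} p F) :
    SubgroupCategory.IsSaturated p F := by
  obtain ⟨I, _, _, _, D, hD, hFD⟩ := hF
  obtain ⟨g, hg⟩ := hFD.exists_isFusionLimit
  intro P
  obtain ⟨_, ⟨Γ, hΓ, hP, rfl⟩, hmax⟩ := hg.exists_isConj_isNormalizerMaximal P
  let Q : ClosedSubgroup S := ⟨Γ.ran, GroupRel.isClosed_ran hΓ.isClosed⟩
  obtain ⟨φ, hφ, -⟩ := hg.isFusionSystem.exists_isIso hΓ (P := P) (Q := Q) hP rfl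
  obtain ⟨U, χ, Δ, B, hN, hrec, hindex⟩ := hg.exists_isNormalizerLimit hD Q
  exact ⟨Q, ⟨φ, hφ⟩, hN.isReceptive hg hmax hrec, hN.isFullyAutomized hg hmax hindex⟩

theorem mainTheorem3 (p : ℕ) [Fact p.Prime] {S : Type u} [Group S] [TopologicalSpace S]
    [IsTopologicalGroup S] [CompactSpace S] [T2Space S] [TotallyDisconnectedSpace S]
    (F : SubgroupCategory S)
    (hF : SubgroupCategory.IsCountablyBased.{u, v} p F)
    (hF' : SubgroupCategory.IsProSaturated.{u, w, x} p F) :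
    SubgroupCategory.IsSaturated p F :=
  mainTheorem3_general p F hF'
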